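/- Let $N\ge 1$ and $n\ge 4N$ be integers. Let $\Gamma=\mathrm{diag}(1_{2N},-1_{2N})$ and $\mathrm U(2N,2N)=\{U\in \mathrm{GL}(4N,\mathbb C): U^\dagger\Gamma U=\Gamma\}$, and write its elements in $2N\times 2N$ blocks as $U=\begin{pmatrix}A&C\\B&D\end{pmatrix}$. Let $\mathbb D_{4N^2}=\{Z\in \mathrm{Mat}_{2N\times 2N}(\mathbb C): 1-Z^\dagger Z>0\}$, and let $\mathcal H_n(\mathbb D_{4N^2})$ be the space of holomorphic functions on $\mathbb D_{4N^2}$ that are square-integrable with respect to the measure $$d\mu_n(Z)=c_n\det(1-ZZ^\dagger)^{n-4N}\,|dZ|,\qquad c_n=\pi^{-4N^2}\prod_{j=1}^{2N}\frac{(n-j)!}{(n-2N-j)!},$$ where $|dZ|$ is Lebesgue measure on $\mathbb C^{4N^2}$, with scalar product $\langle\phi|\phi'\rangle=\int_{\mathbb D_{4N^2}}\overline{\phi}\,\phi'\,d\mu_n$. Then $\mathcal H_n(\mathbb D_{4N^2})$ is a Hilbert space, and the formula $$[\mathcal U_n(U)\phi](Z)=\det(A^\dagger-B^\dagger Z)^{-n}\,\phi\big((D^\dagger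 Z-C^\dagger)(A^\dagger-B^\dagger Z)^{-1}\big)$$ defines a unitary irreducible square-integrable (discrete series) representation of $\mathrm U(2N,2N)$ on it. That is, each $\mathcal U_n(U)$ is a unitary operator on $\mathcal H_n(\mathbb D_{4N^2})$; $\mathcal U_n(UU')=\mathcal U_n(U)\,\mathcal U_n(U')$; for each $\phi$ the map $U\mapsto \mathcal U_n(U)\phi$ is continuous; $\mathcal H_n(\mathbb D_{4N^2})\neq 0$ and its only closed invariant subspaces are $0$ and $\mathcal H_n(\mathbb D_{4N^2})$; and all matrix coefficients $U\mapsto\langle\phi|\mathcal U_n(U)\phi'\rangle$ are square-integrable on $\mathrm U(2N,2N)$ with respect to Haar measure. -/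

import Mathlib

open scoped Matrix ComplexOrder
open MeasureTheory

/-! ## The group `U(m, m)` -/

namespace ColoredConformal

/-- The Hermitian form `Γ = diag(1, …, 1, -1, …, -1)` of signature `(m, m)`. -/
def Gam (m : ℕ) : Matrix (Fin m ⊕ Fin m) (Fin m ⊕ Fin m) ℂ :=
  Matrix.fromBlocks 1 0 0 (-1)

/-- The pseudo-unitary group `U(m, m) = {U : U† Γ U = Γ}`, with the topology of `GL(2m, ℂ)`. -/
def pseudoUnitary (m : ℕ) : Subgroup (GL (Fin m ⊕ Fin m) ℂ) where
  carrier := {U | (U : Matrix (Fin m ⊕ Fin m) (Fin m ⊕ Fin m) ℂ)ᴴ * Gam m *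
    (U : Matrix (Fin m ⊕ Fin m) (Fin m ⊕ Fin m) ℂ) = Gam m}
  one_mem' := by simp
  mul_mem' := by
    intro U V hU hV
    simp only [Set.mem_ofPred_eq] at hU hV ⊢
    rw [Units.val_mul, Matrix.conjTranspose_mul]
    calc _ = (V : Matrix (Fin m ⊕ Fin m) (Fin m ⊕ Fin m) ℂ)ᴴ *
          ((U : Matrix (Fin m ⊕ Fin m) (Fin m ⊕ Fin m) ℂ)ᴴ * Gam m *
            (U : Matrix (Fin m ⊕ Fin m) (Fin m ⊕ Fin m) ℂ)) *
          (V : Matrix (Fin m ⊕ Fin m) (Fin m ⊕ Fin m) ℂ) := by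
            simp only [Matrix.mul_assoc]
      _ = Gam m := by rw [hU, hV]
  inv_mem' := by
    intro U hU
    simp only [Set.mem_ofPred_eq] at hU ⊢
    have h1 : (U : Matrix (Fin m ⊕ Fin m) (Fin m ⊕ Fin m) ℂ) *
        ((U⁻¹ : GL (Fin m ⊕ Fin m) ℂ) : Matrix (Fin m ⊕ Fin m) (Fin m ⊕ Fin m) ℂ) = 1 :=
      Units.mul_inv U
    have h2 : ((U⁻¹ : GL (Fin m ⊕ Fin m) ℂ) : Matrix (Fin m ⊕ Fin m) (Fin m ⊕ Fin m) ℂ)ᴴ *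
        (U : Matrix (Fin m ⊕ Fin m) (Fin m ⊕ Fin m) ℂ)ᴴ = 1 := by
      rw [← Matrix.conjTranspose_mul, h1, Matrix.conjTranspose_one]
    set X := (U : Matrix (Fin m ⊕ Fin m) (Fin m ⊕ Fin m) ℂ)
    set Y := ((U⁻¹ : GL (Fin m ⊕ Fin m) ℂ) : Matrix (Fin m ⊕ Fin m) (Fin m ⊕ Fin m) ℂ)
    calc Yᴴ * Gam m * Y = Yᴴ * (Xᴴ * Gam m * X) * Y := by rw [hU]
      _ = (Yᴴ * Xᴴ) * Gam m * (X * Y) := by simp only [Matrix.mul_assoc]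
      _ = Gam m := by rw [h1, h2, Matrix.one_mul, Matrix.mul_one]

instance (m : ℕ) : LocallyCompactSpace (Matrix (Fin m ⊕ Fin m) (Fin m ⊕ Fin m) ℂ) :=
  inferInstanceAs (LocallyCompactSpace (Fin m ⊕ Fin m → Fin m ⊕ Fin m → ℂ))

instance (m : ℕ) : LocallyCompactSpace (pseudoUnitary m) := by
  have hc : IsClosed ((pseudoUnitary m : Subgroup (GL (Fin m ⊕ Fin m) ℂ)) :
      Set (GL (Fin m ⊕ Fin m) ℂ)) := by
    have hv : Continuous fun U : GL (Fin m ⊕ Fin m) ℂ =>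
        (U : Matrix (Fin m ⊕ Fin m) (Fin m ⊕ Fin m) ℂ) := Units.continuous_val
    exact isClosed_eq ((hv.matrix_conjTranspose.mul continuous_const).mul hv) continuous_const
  exact hc.isClosedEmbedding_subtypeVal.locallyCompactSpace

/-- The group `U(m, m)` carries its Borel σ-algebra. -/
noncomputable instance (m : ℕ) : MeasurableSpace (pseudoUnitary m) := borel _

instance (m : ℕ) : BorelSpace (pseudoUnitary m) := ⟨rfl⟩

/-! The blocks of `U = (A C; B D)`. -/

/-- Upper left block `A` of `U`. -/
def blkA {m : ℕ} (U : pseudoUnitary m) : Matrix (Fin m) (Fin m) ℂ :=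
  ((U : GL (Fin m ⊕ Fin m) ℂ) : Matrix (Fin m ⊕ Fin m) (Fin m ⊕ Fin m) ℂ).toBlocks₁₁

/-- Lower left block `B` of `U`. -/
def blkB {m : ℕ} (U : pseudoUnitary m) : Matrix (Fin m) (Fin m) ℂ :=
  ((U : GL (Fin m ⊕ Fin m) ℂ) : Matrix (Fin m ⊕ Fin m) (Fin m ⊕ Fin m) ℂ).toBlocks₂₁

/-- Upper right block `C` of `U`. -/
def blkC {m : ℕ} (U : pseudoUnitary m) : Matrix (Fin m) (Fin m) ℂ :=
  ((U : GL (Fin m ⊕ Fin m) ℂ) : Matrix (Fin m ⊕ Fin m) (Fin m ⊕ Fin m) ℂ).toBlocks₁₂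

/-- Lower right block `D` of `U`. -/
def blkD {m : ℕ} (U : pseudoUnitary m) : Matrix (Fin m) (Fin m) ℂ :=
  ((U : GL (Fin m ⊕ Fin m) ℂ) : Matrix (Fin m ⊕ Fin m) (Fin m ⊕ Fin m) ℂ).toBlocks₂₂

/-! ## The matrix ball and its weighted Bergman space -/

/-- The matrix ball `{Z : 1 - Z† Z > 0}` of `m × m` complex matrices. -/
def matrixBall (m : ℕ) : Set (Matrix (Fin m) (Fin m) ℂ) :=
  {Z | (1 - Zᴴ * Z).PosDef}

/-- Lebesgue measure `|dZ|` on the space `ℂ^(m²)` of `m × m` complex matrices. -/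
noncomputable instance (m : ℕ) : MeasureSpace (Matrix (Fin m) (Fin m) ℂ) :=
  inferInstanceAs (MeasureSpace (Fin m → Fin m → ℂ))

/-- The constant `c_n = π^(-4N²) ∏_{j=1}^{2N} (n - j)! / (n - 2N - j)!`, meant for `n ≥ 4N`
(where none of the subtractions truncates). -/
noncomputable def cConst (N n : ℕ) : ℝ :=
  (Real.pi ^ (4 * N ^ 2))⁻¹ *
    ∏ j ∈ Finset.Icc 1 (2 * N), ((n - j).factorial : ℝ) / ((n - 2 * N - j).factorial : ℝ)

/-- The measure `c_n det(1 - Z Z†)^(n - 4N) |dZ|` on the ball of `2N × 2N` matrices, as a measure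
on the space of all matrices that is concentrated on the ball; meant for `n ≥ 4N`. The determinant
is real and positive on the ball. -/
noncomputable def ballMeasure (N n : ℕ) : Measure (Matrix (Fin (2 * N)) (Fin (2 * N)) ℂ) :=
  (volume.restrict (matrixBall (2 * N))).withDensity fun Z =>
    ENNReal.ofReal (cConst N n * (1 - Z * Zᴴ).det.re ^ (n - 4 * N))

/-- The space of holomorphic functions on the ball that are square-integrable with respect to
`ballMeasure N n`, as a subspace of `L²(ballMeasure N n)` with the inner product
`⟪f, g⟫ = ∫ conj (f Z) * g Z`: the classes that are represented by a function that is holomorphic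
on the ball. -/
noncomputable def bergman (N n : ℕ) : Submodule ℂ (Lp ℂ 2 (ballMeasure N n)) where
  carrier := {f | ∃ φ : Matrix (Fin (2 * N)) (Fin (2 * N)) ℂ → ℂ,
    DifferentiableOn ℂ φ (matrixBall (2 * N)) ∧ f =ᵐ[ballMeasure N n] φ}
  zero_mem' := ⟨fun _ => 0, differentiableOn_const 0, Lp.coeFn_zero ℂ 2 _⟩
  add_mem' := by
    rintro f g ⟨φ, hφ, hf⟩ ⟨ψ, hψ, hg⟩
    let _ : NormedAddCommGroup (Matrix (Fin (2 * N)) (Fin (2 * N)) ℂ) := Matrix.normedAddCommGroup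
    let _ : NormedSpace ℂ (Matrix (Fin (2 * N)) (Fin (2 * N)) ℂ) := Matrix.normedSpace
    exact ⟨φ + ψ, DifferentiableOn.add hφ hψ, (Lp.coeFn_add f g).trans (hf.add hg)⟩
  smul_mem' := by
    rintro c f ⟨φ, hφ, hf⟩
    let _ : NormedAddCommGroup (Matrix (Fin (2 * N)) (Fin (2 * N)) ℂ) := Matrix.normedAddCommGroup
    let _ : NormedSpace ℂ (Matrix (Fin (2 * N)) (Fin (2 * N)) ℂ) := Matrix.normedSpace
    exact ⟨c • φ, DifferentiableOn.const_smul hφ c, (Lp.coeFn_smul c f).trans (hf.const_smul c)⟩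

/-- The action `φ ↦ det(A† - B† Z)^(-n) φ((D† Z - C†) (A† - B† Z)⁻¹)` on functions of `Z`. -/
noncomputable def act {m : ℕ} (n : ℕ) (U : pseudoUnitary m)
    (φ : Matrix (Fin m) (Fin m) ℂ → ℂ) : Matrix (Fin m) (Fin m) ℂ → ℂ := fun Z =>
  ((blkA U)ᴴ - (blkB U)ᴴ * Z).det ^ (-(n : ℤ)) *
    φ (((blkD U)ᴴ * Z - (blkC U)ᴴ) * ((blkA U)ᴴ - (blkB U)ᴴ * Z)⁻¹)

end ColoredConformal

/-! ## Unitary representations -/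

namespace UnitaryRepr

variable {G : Type*} [Group G] {H : Type*} [NormedAddCommGroup H] [InnerProductSpace ℂ H]

/-- Strong continuity of a unitary representation: all orbit maps are continuous. -/
def IsStronglyContinuous [TopologicalSpace G] (ρ : G →* (H ≃ₗᵢ[ℂ] H)) : Prop :=
  ∀ v : H, Continuous fun g => ρ g v

/-- (Topological) irreducibility of a unitary representation: the space is nonzero, and the only
closed invariant subspaces are `0` and the whole space. -/
def IsIrreducible (ρ : G →* (H ≃ₗᵢ[ℂ] H)) : Prop :=
  Nontrivial H ∧ ∀ K : Submodule ℂ H, IsClosed (K : Set H) →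
    (∀ g, ∀ v ∈ K, ρ g v ∈ K) → K = ⊥ ∨ K = ⊤

/-- Square-integrability of a unitary representation with respect to a measure on the group: all
matrix coefficients `g ↦ ⟪v, ρ(g) w⟫` are square-integrable. -/
def IsSquareIntegrable [MeasurableSpace G] (μ : MeasureTheory.Measure G)
    (ρ : G →* (H ≃ₗᵢ[ℂ] H)) : Prop :=
  ∀ v w : H, MeasureTheory.MemLp (fun g => inner ℂ v (ρ g w)) 2 μ

end UnitaryRepr

/-! ### The group: inverses, products and block identities -/

namespace ColoredConformal

variable {m : ℕ}

/-! The group acts on the ball by `mob g Z = (B + D Z)(A + C Z)⁻¹`, and `act n U` is pull-back along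
`mob U⁻¹` times the factor `det(den U⁻¹ Z)^(-n)`. On passing from `Z` to `mob U Z`, the function
`det(1 - Z Z†)` is divided by `|det den|²` and Lebesgue measure by `|det den|^(4m)`. With `m = 2N`
the weight `n - 4N` is exactly the one that makes `act` isometric; of `c_n` only its positivity
matters.

Everything else rests on the constant function `e = 1` and the circle `Z ↦ e^{iθ} Z`. By the mean
value property, averaging the operators over the circle gives `u ↦ u(0) e`, the orthogonal
projection to the line of `e`; so `e` is, up to a scalar, the reproducing kernel at the origin
(`rep_zero_mul`). The action on the ball is transitive (`exists_hermitian_mob_zero`), so point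
evaluations are locally uniformly bounded, which gives completeness, and a vector orthogonal to the
orbit of `e` vanishes at every point: `e` is cyclic.

A closed invariant subspace is either orthogonal to `e`, hence zero, or contains the nonzero
projection of one of its vectors to the line of `e`, hence is everything. Strong continuity follows
from that of the single coefficient `⟪e, ρ(g) e⟫`.

For square-integrability, `|⟪v, ρ(g) e⟫|²` is a constant times `det(1 - Z Z†)^n |v(Z)|²` at `Z = mob
g 0`. Haar measure is pushed to a multiple of the invariant measure `det(1 - Z Z†)^(-2m) |dZ|`
(`exists_lintegral_haar_eq`), so the integral is a multiple of `‖v‖²`. Averaging over the circle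
gives Schur orthogonality on the span of the orbit of `e`, and Fatou's lemma extends the bound to
all vectors. Both arguments need Haar measure to be right invariant, which is proved from the polar
decomposition. -/

theorem Gam_mul_Gam (m : ℕ) : Gam m * Gam m = 1 := by
  simp [Gam, Matrix.fromBlocks_multiply, ← Matrix.fromBlocks_one]

theorem Gam_conjTranspose (m : ℕ) : (Gam m)ᴴ = Gam m := by
  simp [Gam, Matrix.fromBlocks_conjTranspose]

/-- The element of `U(m, m)` given by a matrix that preserves the Hermitian form. -/
def ofMatrix (M : Matrix (Fin m ⊕ Fin m) (Fin m ⊕ Fin m) ℂ) (h : Mᴴ * Gam m * M = Gam m) :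
    pseudoUnitary m :=
  have h' : Gam m * Mᴴ * Gam m * M = 1 := by
    rw [Matrix.mul_assoc, Matrix.mul_assoc, ← Matrix.mul_assoc Mᴴ, h, Gam_mul_Gam]
  ⟨⟨M, Gam m * Mᴴ * Gam m, mul_eq_one_comm.1 h', h'⟩, h⟩

@[simp]
theorem ofMatrix_val (M : Matrix (Fin m ⊕ Fin m) (Fin m ⊕ Fin m) ℂ) (h : Mᴴ * Gam m * M = Gam m) :
    (ofMatrix M h).1.1 = M := rfl

theorem ext_val {U V : pseudoUnitary m} (h : U.1.1 = V.1.1) : U = V :=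
  Subtype.ext (Units.ext h)

theorem val_inv (U : pseudoUnitary m) : (U⁻¹).1.1 = Gam m * U.1.1ᴴ * Gam m := by
  have h : ofMatrix U.1.1 U.2 = U := ext_val rfl
  conv_lhs => rw [← h]
  rfl

theorem val_mul (U V : pseudoUnitary m) : (U * V).1.1 = U.1.1 * V.1.1 := rfl

theorem val_one : (1 : pseudoUnitary m).1.1 = 1 := rfl

theorem val_eq_fromBlocks (U : pseudoUnitary m) :
    U.1.1 = Matrix.fromBlocks (blkA U) (blkC U) (blkB U) (blkD U) :=
  (Matrix.fromBlocks_toBlocks U.1.1).symm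

theorem blkA_inv (U : pseudoUnitary m) : blkA U⁻¹ = (blkA U)ᴴ := by
  rw [blkA, val_inv, val_eq_fromBlocks U]
  simp [Gam, Matrix.fromBlocks_multiply, Matrix.fromBlocks_conjTranspose]

theorem blkB_inv (U : pseudoUnitary m) : blkB U⁻¹ = -(blkC U)ᴴ := by
  rw [blkB, val_inv, val_eq_fromBlocks U]
  simp [Gam, Matrix.fromBlocks_multiply, Matrix.fromBlocks_conjTranspose]

theorem blkC_inv (U : pseudoUnitary m) : blkC U⁻¹ = -(blkB U)ᴴ := by
  rw [blkC, val_inv, val_eq_fromBlocks U]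
  simp [Gam, Matrix.fromBlocks_multiply, Matrix.fromBlocks_conjTranspose]

theorem blkD_inv (U : pseudoUnitary m) : blkD U⁻¹ = (blkD U)ᴴ := by
  rw [blkD, val_inv, val_eq_fromBlocks U]
  simp [Gam, Matrix.fromBlocks_multiply, Matrix.fromBlocks_conjTranspose]

theorem blkA_mul (U V : pseudoUnitary m) : blkA (U * V) = blkA U * blkA V + blkC U * blkB V := by
  rw [blkA, val_mul, val_eq_fromBlocks U, val_eq_fromBlocks V]
  simp [Matrix.fromBlocks_multiply]

theorem blkB_mul (U V : pseudoUnitary m) : blkB (U * V) = blkB U * blkA V + blkD U * blkB V := by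
  rw [blkB, val_mul, val_eq_fromBlocks U, val_eq_fromBlocks V]
  simp [Matrix.fromBlocks_multiply]

theorem blkC_mul (U V : pseudoUnitary m) : blkC (U * V) = blkA U * blkC V + blkC U * blkD V := by
  rw [blkC, val_mul, val_eq_fromBlocks U, val_eq_fromBlocks V]
  simp [Matrix.fromBlocks_multiply]

theorem blkD_mul (U V : pseudoUnitary m) : blkD (U * V) = blkB U * blkC V + blkD U * blkD V := by
  rw [blkD, val_mul, val_eq_fromBlocks U, val_eq_fromBlocks V]
  simp [Matrix.fromBlocks_multiply]

theorem blkA_one : blkA (1 : pseudoUnitary m) = 1 := by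
  simp [blkA, ← Matrix.fromBlocks_one]

theorem blkB_one : blkB (1 : pseudoUnitary m) = 0 := by
  simp [blkB, ← Matrix.fromBlocks_one]

theorem blkC_one : blkC (1 : pseudoUnitary m) = 0 := by
  simp [blkC, ← Matrix.fromBlocks_one]

theorem blkD_one : blkD (1 : pseudoUnitary m) = 1 := by
  simp [blkD, ← Matrix.fromBlocks_one]

theorem block_relations (U : pseudoUnitary m) :
    (blkA U)ᴴ * blkA U - (blkB U)ᴴ * blkB U = 1 ∧ (blkA U)ᴴ * blkC U = (blkB U)ᴴ * blkD U ∧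
      (blkD U)ᴴ * blkD U - (blkC U)ᴴ * blkC U = 1 := by
  have h := U.2
  change U.1.1ᴴ * Gam m * U.1.1 = Gam m at h
  rw [val_eq_fromBlocks U] at h
  simp only [Gam, Matrix.fromBlocks_multiply, Matrix.fromBlocks_conjTranspose,
    Matrix.fromBlocks_inj, Matrix.mul_one, Matrix.mul_zero, add_zero, zero_add, Matrix.mul_neg,
    Matrix.neg_mul] at h
  obtain ⟨h1, h2, -, h4⟩ := h
  refine ⟨by rw [← h1, sub_eq_add_neg], ?_, ?_⟩
  · exact eq_of_sub_eq_zero (by rw [sub_eq_add_neg, h2])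
  · rw [← neg_inj, ← h4]; abel

/-- The relations between rows of blocks are the column relations of `U⁻¹ = Γ U† Γ`. -/
theorem blkA_mul_conjTranspose (U : pseudoUnitary m) :
    blkA U * (blkA U)ᴴ - blkC U * (blkC U)ᴴ = 1 := by
  simpa [blkA_inv, blkB_inv] using (block_relations U⁻¹).1

theorem blkA_mul_conjTranspose_blkB (U : pseudoUnitary m) :
    blkA U * (blkB U)ᴴ = blkC U * (blkD U)ᴴ := by
  simpa [blkA_inv, blkB_inv, blkC_inv, blkD_inv] using (block_relations U⁻¹).2.1

theorem blkD_mul_conjTranspose (U : pseudoUnitary m) :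
    blkD U * (blkD U)ᴴ - blkB U * (blkB U)ᴴ = 1 := by
  simpa [blkD_inv, blkC_inv] using (block_relations U⁻¹).2.2

/-! ### The action on the ball by fractional linear maps -/

/-- The denominator `A + C Z` of the fractional linear map of `U`. -/
def den (U : pseudoUnitary m) (Z : Matrix (Fin m) (Fin m) ℂ) : Matrix (Fin m) (Fin m) ℂ :=
  blkA U + blkC U * Z

/-- The numerator `B + D Z` of the fractional linear map of `U`. -/
def num (U : pseudoUnitary m) (Z : Matrix (Fin m) (Fin m) ℂ) : Matrix (Fin m) (Fin m) ℂ :=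
  blkB U + blkD U * Z

/-- The fractional linear map `Z ↦ (B + D Z) (A + C Z)⁻¹`. -/
noncomputable def mob (U : pseudoUnitary m) (Z : Matrix (Fin m) (Fin m) ℂ) :
    Matrix (Fin m) (Fin m) ℂ :=
  num U Z * (den U Z)⁻¹

/-- Up to signs, the adjoint blocks in `act` are the blocks of `U⁻¹`. -/
theorem act_apply (n : ℕ) (U : pseudoUnitary m) (φ : Matrix (Fin m) (Fin m) ℂ → ℂ)
    (Z : Matrix (Fin m) (Fin m) ℂ) :
    act n U φ Z = (den U⁻¹ Z).det ^ (-(n : ℤ)) * φ (mob U⁻¹ Z) := by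
  simp only [act, mob, den, num, blkA_inv, blkB_inv, blkC_inv, blkD_inv, Matrix.neg_mul,
    neg_add_eq_sub, ← sub_eq_add_neg]

/-- Both sides are values of the form `Γ`, on the columns `U (1; Z) = (den; num)` and `(1; Z)`.
Positivity of the right side makes `den` invertible and keeps `mob U Z` in the ball. -/
theorem den_sub_num (U : pseudoUnitary m) (Z : Matrix (Fin m) (Fin m) ℂ) :
    (den U Z)ᴴ * den U Z - (num U Z)ᴴ * num U Z = 1 - Zᴴ * Z := by
  obtain ⟨h1, h2, h3⟩ := block_relations U
  have h2' : (blkC U)ᴴ * blkA U = (blkD U)ᴴ * blkB U := by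
    simpa using congrArg Matrix.conjTranspose h2
  simp only [den, num, Matrix.conjTranspose_add, Matrix.conjTranspose_mul, add_mul, mul_add]
  calc _ = ((blkA U)ᴴ * blkA U - (blkB U)ᴴ * blkB U)
        + ((blkA U)ᴴ * blkC U - (blkB U)ᴴ * blkD U) * Z
        + Zᴴ * ((blkC U)ᴴ * blkA U - (blkD U)ᴴ * blkB U)
        - Zᴴ * ((blkD U)ᴴ * blkD U - (blkC U)ᴴ * blkC U) * Z := by noncomm_ring
    _ = _ := by rw [h1, h2, h3, h2']; simp

theorem den_one (Z : Matrix (Fin m) (Fin m) ℂ) : den 1 Z = 1 := by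
  simp [den, blkA_one, blkC_one]

theorem mob_one (Z : Matrix (Fin m) (Fin m) ℂ) : mob 1 Z = Z := by
  simp [mob, den_one, num, blkB_one, blkD_one]

theorem isUnit_det_den (U : pseudoUnitary m) {Z : Matrix (Fin m) (Fin m) ℂ}
    (hZ : Z ∈ matrixBall m) : IsUnit (den U Z).det := by
  have h : ((den U Z)ᴴ * den U Z).PosDef := by
    rw [eq_add_of_sub_eq (den_sub_num U Z)]
    exact Matrix.PosDef.add_posSemidef hZ (Matrix.posSemidef_conjTranspose_mul_self _)
  have := (Matrix.isUnit_iff_isUnit_det _).1 h.isUnit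
  rw [Matrix.det_mul] at this
  exact isUnit_of_mul_isUnit_right this

theorem det_den_ne_zero (U : pseudoUnitary m) {Z : Matrix (Fin m) (Fin m) ℂ}
    (hZ : Z ∈ matrixBall m) : (den U Z).det ≠ 0 :=
  (isUnit_det_den U hZ).ne_zero

theorem mob_mul_den (U : pseudoUnitary m) {Z : Matrix (Fin m) (Fin m) ℂ}
    (hZ : Z ∈ matrixBall m) : mob U Z * den U Z = num U Z := by
  rw [mob, Matrix.mul_assoc, Matrix.nonsing_inv_mul _ (isUnit_det_den U hZ), Matrix.mul_one]

theorem den_mul_one_sub_mob (U : pseudoUnitary m) {Z : Matrix (Fin m) (Fin m) ℂ}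
    (hZ : Z ∈ matrixBall m) :
    (den U Z)ᴴ * (1 - (mob U Z)ᴴ * mob U Z) * den U Z = 1 - Zᴴ * Z := by
  rw [← den_sub_num U Z, ← mob_mul_den U hZ, Matrix.conjTranspose_mul]
  noncomm_ring

theorem mob_mem (U : pseudoUnitary m) {Z : Matrix (Fin m) (Fin m) ℂ}
    (hZ : Z ∈ matrixBall m) : mob U Z ∈ matrixBall m := by
  have hu := isUnit_det_den U hZ
  have hu' := (Matrix.isUnit_iff_isUnit_det _).2 hu
  have h : 1 - (mob U Z)ᴴ * mob U Z =
      ((den U Z)⁻¹)ᴴ * (1 - Zᴴ * Z) * (den U Z)⁻¹ := by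
    rw [← den_mul_one_sub_mob U hZ]
    have h1 : den U Z * (den U Z)⁻¹ = 1 := Matrix.mul_nonsing_inv _ hu
    have h2 : ((den U Z)⁻¹)ᴴ * (den U Z)ᴴ = 1 := by
      rw [← Matrix.conjTranspose_mul, h1, Matrix.conjTranspose_one]
    simp only [Matrix.mul_assoc, h1, Matrix.mul_one]
    rw [← Matrix.mul_assoc, h2, Matrix.one_mul]
  change (1 - (mob U Z)ᴴ * mob U Z).PosDef
  rw [h]
  refine Matrix.PosDef.conjTranspose_mul_mul_same hZ ?_
  apply Matrix.mulVec_injective_of_isUnit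
  exact (Matrix.isUnit_nonsing_inv_iff).2 hu'

/-- This and `den_mul` are the two rows of `U V (1; Z) = U (1; mob V Z) · den V Z`; the second is
the cocycle identity behind `act_mul`. -/
theorem num_mul (U V : pseudoUnitary m) {Z : Matrix (Fin m) (Fin m) ℂ}
    (hZ : Z ∈ matrixBall m) : num (U * V) Z = num U (mob V Z) * den V Z := by
  rw [num, num, add_mul, Matrix.mul_assoc (blkD U), mob_mul_den V hZ, blkB_mul, blkD_mul, num, den]
  noncomm_ring

theorem den_mul (U V : pseudoUnitary m) {Z : Matrix (Fin m) (Fin m) ℂ}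
    (hZ : Z ∈ matrixBall m) : den (U * V) Z = den U (mob V Z) * den V Z := by
  rw [den, den, add_mul, Matrix.mul_assoc (blkC U), mob_mul_den V hZ, blkA_mul, blkC_mul, num, den]
  noncomm_ring

theorem mob_mul (U V : pseudoUnitary m) {Z : Matrix (Fin m) (Fin m) ℂ}
    (hZ : Z ∈ matrixBall m) : mob (U * V) Z = mob U (mob V Z) := by
  have h1 := isUnit_det_den V hZ
  rw [mob, num_mul U V hZ, den_mul U V hZ, Matrix.mul_inv_rev, mob]
  rw [Matrix.mul_assoc, ← Matrix.mul_assoc (den V Z), Matrix.mul_nonsing_inv _ h1, Matrix.one_mul]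
  rfl

theorem mob_inv_mob (U : pseudoUnitary m) {Z : Matrix (Fin m) (Fin m) ℂ}
    (hZ : Z ∈ matrixBall m) : mob U⁻¹ (mob U Z) = Z := by
  rw [← mob_mul _ _ hZ, inv_mul_cancel, mob_one]

theorem mob_mob_inv (U : pseudoUnitary m) {Z : Matrix (Fin m) (Fin m) ℂ}
    (hZ : Z ∈ matrixBall m) : mob U (mob U⁻¹ Z) = Z := by
  rw [← mob_mul _ _ hZ, mul_inv_cancel, mob_one]

theorem injOn_mob (U : pseudoUnitary m) : Set.InjOn (mob U) (matrixBall m) :=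
  Set.LeftInvOn.injOn (f₁' := mob U⁻¹) fun _ hZ => mob_inv_mob U hZ

theorem image_mob (U : pseudoUnitary m) : mob U '' matrixBall m = matrixBall m :=
  Set.Subset.antisymm (Set.image_subset_iff.2 fun _ hZ => mob_mem U hZ)
    fun Z hZ => ⟨mob U⁻¹ Z, mob_mem U⁻¹ hZ, mob_mob_inv U hZ⟩

theorem zero_mem_matrixBall (m : ℕ) : (0 : Matrix (Fin m) (Fin m) ℂ) ∈ matrixBall m := by
  simp [matrixBall, Matrix.PosDef.one]

/-- Equality is asked on the ball only, since `den` may be singular elsewhere. -/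
theorem act_mul (n : ℕ) (U V : pseudoUnitary m) (φ : Matrix (Fin m) (Fin m) ℂ → ℂ) :
    Set.EqOn (act n (U * V) φ) (act n U (act n V φ)) (matrixBall m) := by
  intro Z hZ
  rw [act_apply, act_apply, act_apply, mul_inv_rev, den_mul _ _ hZ, mob_mul _ _ hZ,
    Matrix.det_mul, mul_zpow]
  ring

theorem act_one (n : ℕ) (φ : Matrix (Fin m) (Fin m) ℂ → ℂ) : act n 1 φ = φ := by
  ext Z
  rw [act_apply, inv_one, den_one, mob_one, Matrix.det_one, one_zpow, one_mul]

/-- The determinant `det (1 - Z Z†)` as a real number. -/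
noncomputable def detR (Z : Matrix (Fin m) (Fin m) ℂ) : ℝ := (1 - Z * Zᴴ).det.re

theorem detR_eq (Z : Matrix (Fin m) (Fin m) ℂ) : detR Z = (1 - Zᴴ * Z).det.re := by
  rw [detR, Matrix.det_one_sub_mul_comm]

theorem coe_detR {Z : Matrix (Fin m) (Fin m) ℂ} (hZ : Z ∈ matrixBall m) :
    (detR Z : ℂ) = (1 - Zᴴ * Z).det := by
  have h : 0 < (1 - Zᴴ * Z).det := Matrix.PosDef.det_pos hZ
  rw [detR_eq]
  exact Complex.ext rfl (Complex.lt_def.1 h).2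

theorem detR_pos {Z : Matrix (Fin m) (Fin m) ℂ} (hZ : Z ∈ matrixBall m) : 0 < detR Z := by
  have h : 0 < (1 - Zᴴ * Z).det := Matrix.PosDef.det_pos hZ
  rw [← coe_detR hZ] at h
  exact_mod_cast h

theorem detR_mob (U : pseudoUnitary m) {Z : Matrix (Fin m) (Fin m) ℂ} (hZ : Z ∈ matrixBall m) :
    ‖(den U Z).det‖ ^ 2 * detR (mob U Z) = detR Z := by
  have h := congrArg Matrix.det (den_mul_one_sub_mob U hZ)
  rw [Matrix.det_mul, Matrix.det_mul, Matrix.det_conjTranspose, ← coe_detR hZ,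
    ← coe_detR (mob_mem U hZ), mul_right_comm] at h
  have h3 : star (den U Z).det * (den U Z).det = ((‖(den U Z).det‖ ^ 2 : ℝ) : ℂ) := by
    rw [← starRingEnd_apply, Complex.conj_mul']; push_cast; rfl
  rw [h3] at h
  exact_mod_cast h

end ColoredConformal

/-! ### Transitivity on the ball and the polar decomposition -/

namespace ColoredConformal

variable {m : ℕ}

theorem posDef_one_sub_mul_conjTranspose {Z : Matrix (Fin m) (Fin m) ℂ} (hZ : Z ∈ matrixBall m) :
    (1 - Z * Zᴴ).PosDef := by
  have h1 : (1 - Zᴴ * Z).PosDef := hZ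
  -- The inverse of `1 - Z Z†` is explicit and visibly positive definite.
  have h2 : (1 - Z * Zᴴ) * (1 + Z * (1 - Zᴴ * Z)⁻¹ * Zᴴ) = 1 := by
    have h3 : (1 - Zᴴ * Z) * (1 - Zᴴ * Z)⁻¹ = 1 :=
      Matrix.mul_nonsing_inv _ ((Matrix.isUnit_iff_isUnit_det _).1 h1.isUnit)
    calc _ = 1 - Z * Zᴴ + Z * ((1 - Zᴴ * Z) * (1 - Zᴴ * Z)⁻¹) * Zᴴ := by noncomm_ring
      _ = 1 := by rw [h3]; noncomm_ring
  rw [← Matrix.inv_eq_left_inv h2]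
  apply Matrix.PosDef.inv
  exact Matrix.PosDef.one.add_posSemidef (h1.inv.posSemidef.mul_mul_conjTranspose_same Z)

-- `S` is the inverse square root of `Y`; functional calculus supplies the commutation.
open MatrixOrder in
theorem exists_posDef_sq_of_commute {ι : Type*} [Fintype ι] [DecidableEq ι] {Y : Matrix ι ι ℂ}
    (hY : Y.PosDef) : ∃ S : Matrix ι ι ℂ, Sᴴ = S ∧ S * Y * S = 1 ∧ ∀ X, Commute Y X → Commute S X := by
  have hc : ∀ X, Commute Y X → Commute (CFC.sqrt Y) X := by
    intro X hX
    rw [CFC.sqrt_eq_cfc]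
    exact hX.cfc_nnreal _
  have hs : CFC.sqrt Y * CFC.sqrt Y = Y := CFC.sqrt_mul_sqrt_self Y hY.posSemidef.nonneg
  have hu : IsUnit (CFC.sqrt Y).det := by
    have := (Matrix.isUnit_iff_isUnit_det _).1 hY.isUnit
    rw [← hs, Matrix.det_mul] at this
    exact isUnit_of_mul_isUnit_right this
  have h1 := Matrix.mul_nonsing_inv _ hu
  have h2 := Matrix.nonsing_inv_mul _ hu
  refine ⟨(CFC.sqrt Y)⁻¹, ?_, ?_, fun X hX => ?_⟩
  · rw [Matrix.conjTranspose_nonsing_inv]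
    congr 1
    exact (Matrix.nonneg_iff_posSemidef.1 (CFC.sqrt_nonneg Y)).isHermitian
  · nth_rw 2 [← hs]
    rw [← Matrix.mul_assoc, h2, Matrix.one_mul, h1]
  · have := hc X hX
    change _ * _ = _ * _ at this
    change _ * _ = _ * _
    calc _ = (CFC.sqrt Y)⁻¹ * (X * CFC.sqrt Y) * (CFC.sqrt Y)⁻¹ := by
          rw [Matrix.mul_assoc, Matrix.mul_assoc, h1, Matrix.mul_one]
      _ = _ := by rw [← this, ← Matrix.mul_assoc, h2, Matrix.one_mul]

/-- Every point of the ball is the image of the origin under a Hermitian element of `U(m, m)`. -/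
theorem exists_hermitian_mob_zero {Z : Matrix (Fin m) (Fin m) ℂ} (hZ : Z ∈ matrixBall m) :
    ∃ p : pseudoUnitary m, p.1.1ᴴ = p.1.1 ∧ mob p 0 = Z := by
  -- The element sought is `(1 + X)(1 - X²)^(-1/2)`, where `X` is Hermitian and anticommutes with
  -- `Γ`; hence `(1 + X) Γ (1 + X) = Γ (1 - X²)`.
  set X : Matrix (Fin m ⊕ Fin m) (Fin m ⊕ Fin m) ℂ := Matrix.fromBlocks 0 Zᴴ Z 0 with hX
  have hXX : 1 - X * X = Matrix.fromBlocks (1 - Zᴴ * Z) 0 0 (1 - Z * Zᴴ) := by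
    rw [hX, Matrix.fromBlocks_multiply, ← Matrix.fromBlocks_one, sub_eq_add_neg,
      Matrix.fromBlocks_neg, Matrix.fromBlocks_add]
    simp [sub_eq_add_neg]
  have hY : (1 - X * X).PosDef := by
    rw [hXX]
    have h1 : (1 - Zᴴ * Z).PosDef := hZ
    have h2 := posDef_one_sub_mul_conjTranspose hZ
    let _ := h1.isUnit.invertible
    have h3 : (Matrix.fromBlocks (1 - Zᴴ * Z) 0 0 (1 - Z * Zᴴ)).PosSemidef := by
      have := (h1.fromBlocks₁₁ 0 (1 - Z * Zᴴ)).2 (by simpa using h2.posSemidef)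
      simpa using this
    refine h3.posDef_iff_isUnit.2 ((Matrix.isUnit_iff_isUnit_det _).2 ?_)
    rw [Matrix.det_fromBlocks_zero₂₁]
    exact ((Matrix.isUnit_iff_isUnit_det _).1 h1.isUnit).mul
      ((Matrix.isUnit_iff_isUnit_det _).1 h2.isUnit)
  obtain ⟨S, hS1, hS2, hS3⟩ := exists_posDef_sq_of_commute hY
  have hSX : S * X = X * S := hS3 X (by
    change _ * _ = _ * _
    noncomm_ring)
  have hGX : Gam m * X = - (X * Gam m) := by
    simp [hX, Gam, Matrix.fromBlocks_multiply, Matrix.fromBlocks_neg]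
  have hSG : S * Gam m = Gam m * S := hS3 _ (by
    change _ * _ = _ * _
    rw [hXX]
    simp [Gam, Matrix.fromBlocks_multiply])
  have hXH : Xᴴ = X := by simp [hX, Matrix.fromBlocks_conjTranspose]
  have hp : (((1 + X) * S)ᴴ : Matrix _ _ ℂ) = (1 + X) * S := by
    rw [Matrix.conjTranspose_mul, hS1, Matrix.conjTranspose_add, hXH, Matrix.conjTranspose_one,
      mul_add, add_mul, hSX]
    simp
  have hpG : ((1 + X) * S)ᴴ * Gam m * ((1 + X) * S) = Gam m := by
    rw [hp]
    have h1 : (1 + X) * S = S * (1 + X) := by rw [mul_add, add_mul, hSX]; simp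
    calc (1 + X) * S * Gam m * ((1 + X) * S) = (1 + X) * (S * Gam m) * ((1 + X) * S) := by
          simp only [Matrix.mul_assoc]
      _ = (1 + X) * Gam m * (S * (1 + X)) * S := by rw [hSG]; simp only [Matrix.mul_assoc]
      _ = (Gam m + X * Gam m) * (1 + X) * S * S := by
          rw [← h1, add_mul]; simp only [Matrix.mul_assoc, Matrix.one_mul]
      _ = Gam m * ((1 - X) * (1 + X)) * S * S := by
          rw [show X * Gam m = - (Gam m * X) by rw [hGX, neg_neg]]; noncomm_ring
      _ = Gam m * ((1 - X * X) * S * S) := by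
          rw [show (1 - X) * (1 + X) = 1 - X * X by noncomm_ring]; simp only [Matrix.mul_assoc]
      _ = Gam m := by
          have : S * (1 - X * X) = (1 - X * X) * S := hS3 _ (Commute.refl _)
          rw [← this, hS2, Matrix.mul_one]
  refine ⟨ofMatrix _ hpG, hp, ?_⟩
  -- Commuting with `Γ` forces `S` to be block diagonal, so that `B = Z A` and the origin goes to
  -- `Z`.
  have hS : S = Matrix.fromBlocks S.toBlocks₁₁ 0 0 S.toBlocks₂₂ := by
    have h := hSG
    rw [← Matrix.fromBlocks_toBlocks S] at h ⊢
    simp only [Gam, Matrix.fromBlocks_multiply, Matrix.fromBlocks_inj, Matrix.mul_one,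
      Matrix.mul_zero, add_zero, zero_add, Matrix.mul_neg, Matrix.neg_mul, Matrix.one_mul,
      Matrix.zero_mul] at h
    have hz : ∀ T : Matrix (Fin m) (Fin m) ℂ, T = -T → T = 0 := fun T hT => by
      ext i j
      exact self_eq_neg.1 (congrFun (congrFun hT i) j)
    rw [Matrix.fromBlocks_inj]
    simp only [Matrix.toBlocks_fromBlocks₁₁, Matrix.toBlocks_fromBlocks₂₂, true_and, and_true]
    exact ⟨hz _ h.2.1.symm, hz _ h.2.2.1⟩
  have hp' : (1 + X) * S = Matrix.fromBlocks S.toBlocks₁₁ (Zᴴ * S.toBlocks₂₂)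
      (Z * S.toBlocks₁₁) S.toBlocks₂₂ := by
    conv_lhs => rw [hS]
    rw [hX, ← Matrix.fromBlocks_one, Matrix.fromBlocks_add, Matrix.fromBlocks_multiply]
    simp
  have hA : blkA (ofMatrix _ hpG) = S.toBlocks₁₁ := by
    rw [blkA, ofMatrix_val, hp', Matrix.toBlocks_fromBlocks₁₁]
  have hB : blkB (ofMatrix _ hpG) = Z * S.toBlocks₁₁ := by
    rw [blkB, ofMatrix_val, hp', Matrix.toBlocks_fromBlocks₂₁]
  have hd := isUnit_det_den (ofMatrix _ hpG) (zero_mem_matrixBall m)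
  rw [den, hA, Matrix.mul_zero, add_zero] at hd
  rw [mob, num, den, hA, hB, Matrix.mul_zero, Matrix.mul_zero, add_zero, add_zero,
    Matrix.mul_assoc, Matrix.mul_nonsing_inv _ hd, Matrix.mul_one]

/-- Fixing the origin means `B = 0`; then `A` is unitary, which forces `C = 0` and `D` unitary. -/
theorem conjTranspose_mul_self_of_mob_zero {k : pseudoUnitary m} (hk : mob k 0 = 0) :
    k.1.1ᴴ * k.1.1 = 1 := by
  have hB : blkB k = 0 := by
    have := mob_mul_den k (zero_mem_matrixBall m)
    simpa [hk, num] using this.symm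
  obtain ⟨h1, h2, h3⟩ := block_relations k
  have hA : (blkA k)ᴴ * blkA k = 1 := by simpa [hB] using h1
  have hC : blkC k = 0 := by
    have h4 : (blkA k)ᴴ * blkC k = 0 := by simpa [hB] using h2
    have h5 : blkA k * (blkA k)ᴴ = 1 := mul_eq_one_comm.1 hA
    rw [← Matrix.one_mul (blkC k), ← h5, Matrix.mul_assoc, h4, Matrix.mul_zero]
  have hD : (blkD k)ᴴ * blkD k = 1 := by simpa [hC] using h3
  rw [val_eq_fromBlocks, hB, hC, Matrix.fromBlocks_conjTranspose, Matrix.fromBlocks_multiply]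
  simp [hA, hD]

/-- `diag(1, …, 1, -1, …, -1)` as an element of `U(m, m)`. -/
def gamElt (m : ℕ) : pseudoUnitary m :=
  ofMatrix (Gam m) (by rw [Gam_conjTranspose, Gam_mul_Gam, Matrix.one_mul])

theorem gamElt_mul_mul_gamElt {p : pseudoUnitary m} (hp : p.1.1ᴴ = p.1.1) :
    gamElt m * p * gamElt m = p⁻¹ := by
  apply ext_val
  rw [val_inv, hp]
  rfl

theorem gamElt_mul_gamElt : gamElt m * gamElt m = 1 :=
  ext_val (Gam_mul_Gam m)

/-- A homomorphism to the positive reals that is trivial on unitary elements is trivial. -/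
theorem hom_eq_one_of_unitary (Δ : pseudoUnitary m →* NNReal)
    (h : ∀ k : pseudoUnitary m, k.1.1ᴴ * k.1.1 = 1 → Δ k = 1) (g : pseudoUnitary m) : Δ g = 1 := by
  -- Polar decomposition `g = p k`: `p` is Hermitian with `p · 0 = g · 0`, and `k = p⁻¹ g` fixes the
  -- origin. Conjugation by `Γ` inverts `p`, so `Δ p ^ 2 = 1`.
  obtain ⟨p, hp, hp0⟩ := exists_hermitian_mob_zero (mob_mem g (zero_mem_matrixBall m))
  have h1 : Δ p = 1 := by
    have h2 : Δ (gamElt m * p * gamElt m * p) = 1 := by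
      rw [gamElt_mul_mul_gamElt hp, inv_mul_cancel, map_one]
    have h3 : Δ (gamElt m) * Δ (gamElt m) = 1 := by
      rw [← map_mul, gamElt_mul_gamElt, map_one]
    rw [map_mul, map_mul, map_mul] at h2
    have h4 : Δ p * Δ p = 1 := by
      calc _ = Δ (gamElt m) * Δ (gamElt m) * (Δ p * Δ p) := by rw [h3, one_mul]
        _ = 1 := by rw [← h2]; ring
    rw [← pow_two] at h4
    exact (pow_eq_one_iff_of_nonneg zero_le two_ne_zero).1 h4
  have h5 : Δ (p⁻¹ * g) = 1 := h _ (conjTranspose_mul_self_of_mob_zero (by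
    rw [mob_mul _ _ (zero_mem_matrixBall m), ← hp0, mob_inv_mob _ (zero_mem_matrixBall m)]))
  have : g = p * (p⁻¹ * g) := by group
  rw [this, map_mul, h1, h5, one_mul]

end ColoredConformal

/-! ### Topology of the group and unimodularity -/

namespace ColoredConformal

variable {m : ℕ}

instance (ι κ : Type*) [Fintype ι] [Fintype κ] : SecondCountableTopology (Matrix ι κ ℂ) :=
  inferInstanceAs (SecondCountableTopology (ι → κ → ℂ))

instance (m : ℕ) : BorelSpace (Matrix (Fin m) (Fin m) ℂ) :=
  inferInstanceAs (BorelSpace (Fin m → Fin m → ℂ))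

instance (m : ℕ) : SecondCountableTopology (pseudoUnitary m) :=
  have : SecondCountableTopology (Matrix (Fin m ⊕ Fin m) (Fin m ⊕ Fin m) ℂ)ᵐᵒᵖ :=
    MulOpposite.opHomeomorph.symm.isEmbedding.secondCountableTopology
  have : SecondCountableTopology (GL (Fin m ⊕ Fin m) ℂ) :=
    Units.isEmbedding_embedProduct.secondCountableTopology
  TopologicalSpace.Subtype.secondCountableTopology _

theorem continuous_val : Continuous fun U : pseudoUnitary m => U.1.1 :=
  Units.continuous_val.comp continuous_subtype_val

theorem continuous_ofMatrix {X : Type*} [TopologicalSpace X]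
    {f : X → Matrix (Fin m ⊕ Fin m) (Fin m ⊕ Fin m) ℂ} (hf : Continuous f)
    (h : ∀ x, (f x)ᴴ * Gam m * f x = Gam m) : Continuous fun x => ofMatrix (f x) (h x) := by
  refine Continuous.subtype_mk (Units.continuous_iff.2 ⟨by exact hf, ?_⟩) _
  exact (continuous_const.mul hf.matrix_conjTranspose).mul continuous_const

theorem continuous_blkA : Continuous (blkA : pseudoUnitary m → _) :=
  continuous_val.matrix_submatrix _ _

theorem continuous_blkB : Continuous (blkB : pseudoUnitary m → _) :=
  continuous_val.matrix_submatrix _ _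

theorem continuous_blkC : Continuous (blkC : pseudoUnitary m → _) :=
  continuous_val.matrix_submatrix _ _

theorem continuous_blkD : Continuous (blkD : pseudoUnitary m → _) :=
  continuous_val.matrix_submatrix _ _

/-- The squared Hilbert-Schmidt norm of a matrix. -/
noncomputable def hsNorm {ι : Type*} [Fintype ι] (M : Matrix ι ι ℂ) : ℝ := (Mᴴ * M).trace.re

theorem hsNorm_eq_sum {ι : Type*} [Fintype ι] (M : Matrix ι ι ℂ) :
    hsNorm M = ∑ i, ∑ j, ‖M j i‖ ^ 2 := by
  simp only [hsNorm, Matrix.trace, Matrix.diag, Matrix.mul_apply, Matrix.conjTranspose_apply,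
    Complex.re_sum]
  refine Finset.sum_congr rfl fun i _ => Finset.sum_congr rfl fun j _ => ?_
  rw [← starRingEnd_apply, Complex.conj_mul']
  norm_cast

theorem continuous_hsNorm {ι : Type*} [Fintype ι] :
    Continuous (hsNorm : Matrix ι ι ℂ → ℝ) :=
  Complex.continuous_re.comp
    ((continuous_id.matrix_conjTranspose.matrix_mul continuous_id).matrix_trace)

theorem norm_apply_sq_le_hsNorm {ι : Type*} [Fintype ι] (M : Matrix ι ι ℂ) (i j : ι) :
    ‖M i j‖ ^ 2 ≤ hsNorm M := by
  rw [hsNorm_eq_sum]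
  refine le_trans ?_ (Finset.single_le_sum (f := fun j => ∑ i, ‖M i j‖ ^ 2)
    (fun _ _ => Finset.sum_nonneg fun _ _ => sq_nonneg _) (Finset.mem_univ j))
  exact Finset.single_le_sum (f := fun i => ‖M i j‖ ^ 2) (fun _ _ => sq_nonneg _)
    (Finset.mem_univ i)

/-- The set of elements of `U(m, m)` whose squared Hilbert-Schmidt norm is at most `R`. -/
def normLE (m : ℕ) (R : ℝ) : Set (pseudoUnitary m) := {g | hsNorm g.1.1 ≤ R}

/-- Closedness and boundedness hold in the space of matrices. Compactness passes to the group
because the inverse `Γ M† Γ` is continuous in `M`. -/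
theorem isCompact_normLE (R : ℝ) : IsCompact (normLE m R) := by
  let K : Set (Matrix (Fin m ⊕ Fin m) (Fin m ⊕ Fin m) ℂ) :=
    {M | Mᴴ * Gam m * M = Gam m ∧ hsNorm M ≤ R}
  have hKc : IsClosed K := by
    refine IsClosed.inter ?_ (isClosed_le continuous_hsNorm continuous_const)
    exact isClosed_eq (((continuous_id.matrix_conjTranspose).mul continuous_const).mul
      continuous_id) continuous_const
  have hK : IsCompact K := by
    have hP : IsCompact (Set.univ.pi fun _ : Fin m ⊕ Fin m => Set.univ.pi fun _ : Fin m ⊕ Fin m =>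
        Metric.closedBall (0 : ℂ) (Real.sqrt R)) :=
      isCompact_univ_pi fun _ => isCompact_univ_pi fun _ => isCompact_closedBall _ _
    refine hP.of_isClosed_subset hKc fun M hM i _ j _ => ?_
    rw [mem_closedBall_zero_iff]
    exact Real.le_sqrt_of_sq_le ((norm_apply_sq_le_hsNorm M i j).trans hM.2)
  have : CompactSpace K := isCompact_iff_compactSpace.1 hK
  have hc : Continuous fun M : K => ofMatrix M.1 M.2.1 :=
    continuous_ofMatrix continuous_subtype_val _
  have : normLE m R = Set.range fun M : K => ofMatrix M.1 M.2.1 := by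
    ext g
    constructor
    · intro hg
      exact ⟨⟨g.1.1, g.2, hg⟩, ext_val rfl⟩
    · rintro ⟨M, rfl⟩
      exact M.2.2
  rw [this]
  exact isCompact_range hc

theorem measurableSet_normLE (R : ℝ) : MeasurableSet (normLE m R) :=
  (isCompact_normLE R).measurableSet

theorem hsNorm_mul_unitary {ι : Type*} [Fintype ι] [DecidableEq ι] (M k : Matrix ι ι ℂ)
    (hk : kᴴ * k = 1) : hsNorm (M * k) = hsNorm M := by
  have hk' : k * kᴴ = 1 := mul_eq_one_comm.1 hk
  rw [hsNorm, Matrix.conjTranspose_mul, Matrix.mul_assoc, Matrix.trace_mul_comm, ← Matrix.mul_assoc,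
    Matrix.mul_assoc, Matrix.mul_assoc, hk', Matrix.mul_one, hsNorm]

theorem hsNorm_inv (g : pseudoUnitary m) : hsNorm (g⁻¹).1.1 = hsNorm g.1.1 := by
  rw [val_inv, hsNorm_mul_unitary _ _ (by rw [Gam_conjTranspose, Gam_mul_Gam]), hsNorm, hsNorm,
    Matrix.conjTranspose_mul, Gam_conjTranspose, Matrix.conjTranspose_conjTranspose,
    Matrix.mul_assoc, ← Matrix.mul_assoc (Gam m), Gam_mul_Gam, Matrix.one_mul,
    Matrix.trace_mul_comm]

theorem hsNorm_one : hsNorm (1 : pseudoUnitary m).1.1 = 2 * m := by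
  rw [val_one, hsNorm, Matrix.conjTranspose_one, Matrix.one_mul, Matrix.trace_one]
  simp [two_mul]

theorem normLE_mem_nhds {R : ℝ} (hR : 2 * m < R) : normLE m R ∈ nhds (1 : pseudoUnitary m) := by
  have h : Continuous fun g : pseudoUnitary m => hsNorm g.1.1 := continuous_hsNorm.comp continuous_val
  exact Filter.mem_of_superset ((isOpen_lt h continuous_const).mem_nhds
    (show hsNorm (1 : pseudoUnitary m).1.1 < R by rwa [hsNorm_one])) fun g hg => by
    change hsNorm g.1.1 ≤ R
    change hsNorm g.1.1 < R at hg
    exact hg.le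

/-- Right translation by a unitary element preserves `normLE`, a set of positive finite Haar
measure, so the modular character is trivial there; `hom_eq_one_of_unitary` does the rest. -/
theorem modularCharacter_eq_one (g : pseudoUnitary m) :
    Measure.modularCharacter (G := pseudoUnitary m) g = 1 := by
  refine hom_eq_one_of_unitary _ (fun k hk => ?_) g
  -- Any `R > 2m` would do: `2m` is the value of `hsNorm` at the identity.
  set R : ℝ := 2 * m + 1
  have h1 := Measure.map_right_mul_eq_modularCharacterFun_smul
    (Measure.haar : Measure (pseudoUnitary m)) k
  have h2 := congrArg (fun μ => μ (normLE m R)) h1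
  have h3 : (fun x => x * k) ⁻¹' normLE m R = normLE m R := by
    ext g
    simp only [normLE, Set.mem_preimage, Set.mem_ofPred_eq, val_mul, hsNorm_mul_unitary _ _ hk]
  beta_reduce at h2
  rw [Measure.map_apply (measurable_mul_const k) (measurableSet_normLE R), h3,
    Measure.smul_apply] at h2
  have h4 : (Measure.haar : Measure (pseudoUnitary m)) (normLE m R) ≠ 0 :=
    (Measure.measure_pos_of_mem_nhds _ (normLE_mem_nhds (by simp [R]))).ne'
  have h5 : (Measure.haar : Measure (pseudoUnitary m)) (normLE m R) ≠ ⊤ :=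
    (isCompact_normLE R).measure_lt_top.ne
  rw [ENNReal.smul_def, smul_eq_mul, eq_comm] at h2
  have h6 := (ENNReal.mul_eq_right h4 h5).1 h2
  exact_mod_cast h6

instance : (Measure.haar : Measure (pseudoUnitary m)).IsMulRightInvariant where
  map_mul_right_eq_self g := by
    rw [Measure.map_right_mul_eq_modularCharacterFun_smul]
    have : Measure.modularCharacterFun g = 1 := modularCharacter_eq_one g
    rw [this, one_smul]

/-- The inverse of a right invariant measure is left invariant, hence a multiple of Haar measure;
the inversion-stable set `normLE` shows that the factor is `1`. -/
instance : (Measure.haar : Measure (pseudoUnitary m)).IsInvInvariant where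
  inv_eq_self := by
    set μ := (Measure.haar : Measure (pseudoUnitary m))
    have h1 : μ.inv = μ.inv.haarScalarFactor μ • μ := Measure.isMulLeftInvariant_eq_smul _ _
    set R : ℝ := 2 * m + 1
    have h2 := congrArg (fun ν => ν (normLE m R)) h1
    have h3 : (normLE m R)⁻¹ = normLE m R := by
      ext g
      simp only [normLE, Set.mem_inv, Set.mem_ofPred_eq, hsNorm_inv]
    simp only [Measure.inv_apply, h3, Measure.smul_apply] at h2
    have h4 : μ (normLE m R) ≠ 0 :=
      (Measure.measure_pos_of_mem_nhds _ (normLE_mem_nhds (by simp [R]))).ne'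
    have h5 : μ (normLE m R) ≠ ⊤ := (isCompact_normLE R).measure_lt_top.ne
    rw [ENNReal.smul_def, smul_eq_mul, eq_comm] at h2
    have h6 := (ENNReal.mul_eq_right h4 h5).1 h2
    have h7 : μ.inv.haarScalarFactor μ = 1 := by exact_mod_cast h6
    rw [h1, h7, one_smul]

end ColoredConformal

/-! ### Topology of the matrix ball, and the determinant of `X ↦ P X Q` -/

namespace ColoredConformal

variable {m : ℕ}

instance (m : ℕ) : (volume : Measure (Matrix (Fin m) (Fin m) ℂ)).IsAddHaarMeasure :=
  Measure.pi.isAddHaarMeasure (fun _ : Fin m => (volume : Measure (Fin m → ℂ)))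

theorem smul_mem_matrixBall {Z : Matrix (Fin m) (Fin m) ℂ} (hZ : Z ∈ matrixBall m) {t : ℂ}
    (ht : ‖t‖ ≤ 1) : t • Z ∈ matrixBall m := by
  change (1 - (t • Z)ᴴ * (t • Z)).PosDef
  have h1 : (1 - Zᴴ * Z).PosDef := hZ
  have h2 : 1 - (t • Z)ᴴ * (t • Z) = (1 - Zᴴ * Z) + (((1 - ‖t‖ ^ 2 : ℝ) : ℂ)) • (Zᴴ * Z) := by
    have : star t * t = ((‖t‖ ^ 2 : ℝ) : ℂ) := by
      rw [← starRingEnd_apply, Complex.conj_mul']; push_cast; rfl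
    rw [Matrix.conjTranspose_smul, Matrix.smul_mul, Matrix.mul_smul, smul_smul, this]
    push_cast
    module
  rw [h2]
  refine h1.add_posSemidef ((Matrix.posSemidef_conjTranspose_mul_self Z).smul ?_)
  have : 0 ≤ 1 - ‖t‖ ^ 2 := by nlinarith [norm_nonneg t]
  exact_mod_cast this

/-- Compactness of the set of test vectors is what makes the condition open in `Z`. -/
theorem mem_matrixBall_iff (Z : Matrix (Fin m) (Fin m) ℂ) :
    Z ∈ matrixBall m ↔ ∀ x ∈ Metric.sphere (0 : Fin m → ℂ) 1,
      0 < (star x ⬝ᵥ ((1 - Zᴴ * Z) *ᵥ x)).re := by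
  have hH : (1 - Zᴴ * Z).IsHermitian :=
    Matrix.isHermitian_one.sub (Matrix.isHermitian_conjTranspose_mul_self Z)
  constructor
  · intro h x hx
    have h1 : (1 - Zᴴ * Z).PosDef := h
    have hx0 : x ≠ 0 := by
      rintro rfl
      simp at hx
    exact (Complex.lt_def.1 (h1.dotProduct_mulVec_pos hx0)).1
  · intro h
    refine Matrix.PosDef.of_dotProduct_mulVec_pos hH fun x hx => ?_
    have hn : (0 : ℝ) < ‖x‖ := norm_pos_iff.2 hx
    have h2 := h ((‖x‖ : ℂ)⁻¹ • x) (by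
      rw [mem_sphere_zero_iff_norm, norm_smul, norm_inv, Complex.norm_real, norm_norm,
        inv_mul_cancel₀ hn.ne'])
    have h3 : (star ((‖x‖ : ℂ)⁻¹ • x) ⬝ᵥ ((1 - Zᴴ * Z) *ᵥ ((‖x‖ : ℂ)⁻¹ • x))) =
        (((‖x‖ ^ 2)⁻¹ : ℝ) : ℂ) * (star x ⬝ᵥ ((1 - Zᴴ * Z) *ᵥ x)) := by
      rw [Matrix.mulVec_smul, star_smul, smul_dotProduct, dotProduct_smul, smul_eq_mul, smul_eq_mul,
        ← mul_assoc, ← Complex.ofReal_inv, ← starRingEnd_apply, Complex.conj_ofReal,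
        ← Complex.ofReal_mul, pow_two, mul_inv]
    rw [h3, Complex.re_ofReal_mul] at h2
    have h4 := (pos_iff_pos_of_mul_pos h2).1 (by positivity)
    have h5 : (star x ⬝ᵥ ((1 - Zᴴ * Z) *ᵥ x)).im = 0 := hH.im_star_dotProduct_mulVec_self x
    exact Complex.lt_def.2 ⟨h4, h5.symm⟩

theorem isOpen_matrixBall (m : ℕ) : IsOpen (matrixBall m) := by
  rw [isOpen_iff_mem_nhds]
  intro Z hZ
  have hc : Continuous fun p : Matrix (Fin m) (Fin m) ℂ × (Fin m → ℂ) =>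
      (star p.2 ⬝ᵥ ((1 - p.1ᴴ * p.1) *ᵥ p.2)).re :=
    Complex.continuous_re.comp ((continuous_snd.star).dotProduct
      ((continuous_const.sub (continuous_fst.matrix_conjTranspose.matrix_mul
        continuous_fst)).matrix_mulVec continuous_snd))
  have h := (isCompact_sphere (0 : Fin m → ℂ) 1).eventually_forall_of_forall_eventually
    (x₀ := Z) (P := fun Z x => 0 < (star x ⬝ᵥ ((1 - Zᴴ * Z) *ᵥ x)).re) (fun x hx =>
      (isOpen_lt continuous_const hc).mem_nhds ((mem_matrixBall_iff Z).1 hZ x hx))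
  filter_upwards [h] with W hW using (mem_matrixBall_iff W).2 hW

theorem measurableSet_matrixBall (m : ℕ) : MeasurableSet (matrixBall m) :=
  (isOpen_matrixBall m).measurableSet

theorem norm_apply_le_of_mem_matrixBall {Z : Matrix (Fin m) (Fin m) ℂ} (hZ : Z ∈ matrixBall m)
    (i j : Fin m) : ‖Z i j‖ ≤ 1 := by
  have h1 : (1 - Zᴴ * Z).PosDef := hZ
  have h2 := (Complex.lt_def.1 (h1.diag_pos (i := j))).1
  simp only [Matrix.sub_apply, Matrix.one_apply_eq, Matrix.mul_apply, Matrix.conjTranspose_apply,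
    Complex.zero_re, Complex.sub_re, Complex.one_re, Complex.re_sum, sub_pos] at h2
  have h3 : (star (Z i j) * Z i j).re ≤ ∑ i, (star (Z i j) * Z i j).re := by
    refine Finset.single_le_sum (f := fun i => (star (Z i j) * Z i j).re) (fun k _ => ?_)
      (Finset.mem_univ i)
    rw [← starRingEnd_apply, Complex.conj_mul']
    norm_cast
    positivity
  rw [← starRingEnd_apply, Complex.conj_mul'] at h3
  norm_cast at h3
  nlinarith [norm_nonneg (Z i j)]

theorem volume_matrixBall_lt_top (m : ℕ) : volume (matrixBall m) < ⊤ := by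
  let K : Set (Matrix (Fin m) (Fin m) ℂ) :=
    Set.univ.pi fun _ : Fin m => Set.univ.pi fun _ : Fin m => Metric.closedBall (0 : ℂ) 1
  have h1 : IsCompact K := isCompact_univ_pi fun _ => isCompact_univ_pi fun _ => isCompact_closedBall _ _
  refine (measure_mono fun Z hZ i _ j _ => ?_).trans_lt h1.measure_lt_top
  rw [mem_closedBall_zero_iff]
  exact norm_apply_le_of_mem_matrixBall hZ i j

/-- The linear map `X ↦ P X Q` on matrices. -/
noncomputable def mulMul (P Q : Matrix (Fin m) (Fin m) ℂ) :
    Matrix (Fin m) (Fin m) ℂ →ₗ[ℂ] Matrix (Fin m) (Fin m) ℂ where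
  toFun X := P * X * Q
  map_add' X Y := by rw [mul_add, add_mul]
  map_smul' c X := by simp

/-- Stacking columns turns `X ↦ P X Q` into the Kronecker product of `Qᵀ` and `P`. -/
theorem det_mulMul (P Q : Matrix (Fin m) (Fin m) ℂ) :
    LinearMap.det (mulMul P Q) = P.det ^ m * Q.det ^ m := by
  let e : Matrix (Fin m) (Fin m) ℂ ≃ₗ[ℂ] (Fin m × Fin m → ℂ) :=
    { toFun := Matrix.vec
      invFun := fun v => Matrix.of fun i j => v (j, i)
      map_add' := fun _ _ => rfl
      map_smul' := fun _ _ => rfl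
      left_inv := fun _ => rfl
      right_inv := fun _ => rfl }
  have h : (e : _ →ₗ[ℂ] _) ∘ₗ mulMul P Q ∘ₗ (e.symm : _ →ₗ[ℂ] _) =
      Matrix.toLin' (Matrix.kroneckerMap (fun x y => x * y) Qᵀ P) := by
    refine LinearMap.ext fun v => ?_
    obtain ⟨X, rfl⟩ := e.surjective v
    simp only [LinearMap.comp_apply, LinearEquiv.coe_coe, LinearEquiv.symm_apply_apply,
      Matrix.toLin'_apply]
    have h := (Matrix.kronecker_mulVec_vec P X Qᵀ).symm
    rw [Matrix.transpose_transpose] at h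
    exact h
  rw [← LinearMap.det_conj (mulMul P Q) e, h, LinearMap.det_toLin', Matrix.det_kronecker,
    Matrix.det_transpose]
  simp [mul_comm]

end ColoredConformal

/-! ### Derivative and Jacobian of the fractional linear maps -/

namespace ColoredConformal

variable {m : ℕ}

theorem continuous_den : Continuous fun p : pseudoUnitary m × Matrix (Fin m) (Fin m) ℂ =>
    den p.1 p.2 :=
  (continuous_blkA.comp continuous_fst).add
    ((continuous_blkC.comp continuous_fst).matrix_mul continuous_snd)

theorem continuous_num : Continuous fun p : pseudoUnitary m × Matrix (Fin m) (Fin m) ℂ =>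
    num p.1 p.2 :=
  (continuous_blkB.comp continuous_fst).add
    ((continuous_blkD.comp continuous_fst).matrix_mul continuous_snd)

/-- Writing the inverse as adjugate over determinant gives measurability everywhere, also where
`den` is singular and continuity may fail. -/
theorem measurable_mob : Measurable fun p : pseudoUnitary m × Matrix (Fin m) (Fin m) ℂ =>
    mob p.1 p.2 := by
  have h1 : Continuous fun p : pseudoUnitary m × Matrix (Fin m) (Fin m) ℂ =>
      num p.1 p.2 * (den p.1 p.2).adjugate :=
    continuous_num.matrix_mul continuous_den.matrix_adjugate
  have h2 : Measurable fun p : pseudoUnitary m × Matrix (Fin m) (Fin m) ℂ =>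
      ((den p.1 p.2).det)⁻¹ := continuous_den.matrix_det.measurable.inv
  have h3 : (fun p : pseudoUnitary m × Matrix (Fin m) (Fin m) ℂ => mob p.1 p.2) =
      fun p i j => ((den p.1 p.2).det)⁻¹ * (num p.1 p.2 * (den p.1 p.2).adjugate) i j := by
    ext p i j
    simp [mob, Matrix.inv_def, Ring.inverse_eq_inv']
  rw [h3]
  exact measurable_pi_iff.2 fun i => measurable_pi_iff.2 fun j =>
    h2.mul (h1.matrix_elem i j).measurable

theorem continuousAt_den_inv (U : pseudoUnitary m) {Z : Matrix (Fin m) (Fin m) ℂ}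
    (hZ : Z ∈ matrixBall m) : ContinuousAt (fun W => (den U W)⁻¹) Z := by
  have h : Continuous (den U) := continuous_den.comp (Continuous.prodMk_right U)
  refine ContinuousAt.comp (f := den U) (g := fun M => M⁻¹) ?_ h.continuousAt
  refine continuousAt_matrix_inv _ ?_
  rw [Ring.inverse_eq_inv']
  exact continuousAt_inv₀ (det_den_ne_zero U hZ)

/-- An exact difference formula: replacing `den U W` by `den U Z` on the right gives the derivative.
-/
theorem mob_sub_mob (U : pseudoUnitary m) {Z W : Matrix (Fin m) (Fin m) ℂ}
    (hZ : Z ∈ matrixBall m) (hW : W ∈ matrixBall m) :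
    mob U W - mob U Z = (blkD U - mob U Z * blkC U) * (W - Z) * (den U W)⁻¹ := by
  have h1 : mob U Z = mob U Z * den U W * (den U W)⁻¹ := by
    rw [Matrix.mul_assoc, Matrix.mul_nonsing_inv _ (isUnit_det_den U hW), Matrix.mul_one]
  have h2 := mob_mul_den U hZ
  have h3 : num U W - mob U Z * den U W = (blkD U - mob U Z * blkC U) * (W - Z) := by
    have : num U Z - mob U Z * den U Z = 0 := by rw [h2, sub_self]
    rw [← sub_zero (num U W - _), ← this, num, num, den, den]
    noncomm_ring
  rw [← h3, sub_mul, ← h1]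
  rfl

/-- The derivative of the fractional linear map of `U`. -/
noncomputable def mobDeriv (U : pseudoUnitary m) (Z : Matrix (Fin m) (Fin m) ℂ) :
    Matrix (Fin m) (Fin m) ℂ →L[ℂ] Matrix (Fin m) (Fin m) ℂ :=
  LinearMap.toContinuousLinearMap (mulMul (blkD U - mob U Z * blkC U) (den U Z)⁻¹)

/-- The error made by that replacement, in coordinates: a factor linear in `W - Z` times one that
tends to zero. -/
theorem isLittleO_mul_sub_mul (P : Matrix (Fin m) (Fin m) ℂ)
    (Q : (Fin m → Fin m → ℂ) → Matrix (Fin m) (Fin m) ℂ) (Z : Fin m → Fin m → ℂ)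
    (hQ : ∀ k j, Filter.Tendsto (fun W => Q W k j) (nhds Z) (nhds 0)) :
    (fun (W : Fin m → Fin m → ℂ) i j => ∑ k, (∑ l, P i l * (W l k - Z l k)) * Q W k j) =o[nhds Z]
      fun W => W - Z := by
  refine Asymptotics.isLittleO_pi.2 fun i => Asymptotics.isLittleO_pi.2 fun j => ?_
  refine Asymptotics.IsLittleO.fun_sum fun k _ => ?_
  simp only [Finset.sum_mul]
  refine Asymptotics.IsLittleO.fun_sum fun l _ => ?_
  have h2 : (fun W : Fin m → Fin m → ℂ => W l k - Z l k) =O[nhds Z] fun W => W - Z :=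
    Asymptotics.IsBigO.of_bound 1 (Filter.Eventually.of_forall fun W => by
      rw [one_mul]
      exact (norm_le_pi_norm ((W - Z) l) k).trans (norm_le_pi_norm (W - Z) l))
  have h3 : (fun W => Q W k j) =o[nhds Z] fun _ => (1 : ℝ) := by
    rw [Asymptotics.isLittleO_one_iff]
    exact hQ k j
  have h5 := (h2.const_mul_left (P i l)).norm_right.mul_isLittleO h3
  simp only [mul_one] at h5
  exact h5.of_norm_right

theorem hasFDerivAt_mob (U : pseudoUnitary m) {Z : Matrix (Fin m) (Fin m) ℂ}
    (hZ : Z ∈ matrixBall m) : HasFDerivAt (𝕜 := ℂ) (mob U) (mobDeriv U Z) Z := by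
  refine HasFDerivAt.of_isLittleO (𝕜 := ℂ) (E := Fin m → Fin m → ℂ) (F := Fin m → Fin m → ℂ) ?_
  set P := blkD U - mob U Z * blkC U with hP
  refine (isLittleO_mul_sub_mul P (fun W => (den U W)⁻¹ - (den U Z)⁻¹) Z fun k j => ?_).congr'
    ?_ (Filter.EventuallyEq.refl _ _)
  · have h4 : Filter.Tendsto (fun W => (den U W)⁻¹ k j) (nhds Z) (nhds ((den U Z)⁻¹ k j)) :=
      ((continuous_id.matrix_elem k j).tendsto _).comp (continuousAt_den_inv U hZ)
    have h5 := h4.sub_const ((den U Z)⁻¹ k j)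
    rw [sub_self] at h5
    exact h5
  · filter_upwards [(isOpen_matrixBall m).mem_nhds hZ] with W hW
    let X : Matrix (Fin m) (Fin m) ℂ := W
    change (fun i j => _) = mob U X - mob U Z - mobDeriv U Z (X - Z)
    refine Eq.trans (b := P * (X - Z) * ((den U X)⁻¹ - (den U Z)⁻¹)) ?_ ?_
    · ext i j
      simp only [Matrix.mul_apply]
      rfl
    · rw [mul_sub (P * (X - Z)), hP, ← mob_sub_mob U hZ hW]
      rfl

/-- The mirror image of `den_mul_one_sub_mob` for `1 - Z Z†`. Comparing determinants of the two
identifies `|det|` of the left factor of the derivative as `|det den|⁻¹`. -/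
theorem deriv_mul_one_sub (U : pseudoUnitary m) {Z : Matrix (Fin m) (Fin m) ℂ}
    (hZ : Z ∈ matrixBall m) :
    (blkD U - mob U Z * blkC U) * (1 - Z * Zᴴ) * (blkD U - mob U Z * blkC U)ᴴ =
      1 - mob U Z * (mob U Z)ᴴ := by
  set W := mob U Z
  have h1 : (blkD U - W * blkC U) * Z = W * blkA U - blkB U := by
    have h : W * den U Z - num U Z = 0 := by rw [mob_mul_den U hZ, sub_self]
    rw [← sub_zero (W * blkA U - blkB U), ← h, num, den]
    noncomm_ring
  have h2 := blkA_mul_conjTranspose U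
  have h3 := blkD_mul_conjTranspose U
  have h4 := blkA_mul_conjTranspose_blkB U
  have h5 : blkB U * (blkA U)ᴴ = blkD U * (blkC U)ᴴ := by
    simpa using congrArg Matrix.conjTranspose h4
  calc _ = (blkD U - W * blkC U) * (blkD U - W * blkC U)ᴴ
        - ((blkD U - W * blkC U) * Z) * ((blkD U - W * blkC U) * Z)ᴴ := by
          rw [Matrix.conjTranspose_mul]; noncomm_ring
    _ = (blkD U * (blkD U)ᴴ - blkB U * (blkB U)ᴴ)
        + W * (blkA U * (blkB U)ᴴ - blkC U * (blkD U)ᴴ)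
        + (blkB U * (blkA U)ᴴ - blkD U * (blkC U)ᴴ) * Wᴴ
        - W * (blkA U * (blkA U)ᴴ - blkC U * (blkC U)ᴴ) * Wᴴ := by
          rw [h1]
          simp only [Matrix.conjTranspose_sub, Matrix.conjTranspose_mul]
          noncomm_ring
    _ = _ := by rw [h2, h3, h4, h5]; simp

theorem norm_det_deriv (U : pseudoUnitary m) {Z : Matrix (Fin m) (Fin m) ℂ}
    (hZ : Z ∈ matrixBall m) :
    ‖(blkD U - mob U Z * blkC U).det‖ = ‖(den U Z).det‖⁻¹ := by
  have h := congrArg (fun M => ‖M.det‖) (deriv_mul_one_sub U hZ)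
  simp only [Matrix.det_mul, Matrix.det_conjTranspose, norm_mul, norm_star] at h
  have h1 : ∀ {W : Matrix (Fin m) (Fin m) ℂ}, W ∈ matrixBall m → ‖(1 - W * Wᴴ).det‖ = detR W := by
    intro W hW
    rw [Matrix.det_one_sub_mul_comm, ← coe_detR hW, Complex.norm_real, Real.norm_of_nonneg
      (detR_pos hW).le]
  rw [h1 hZ, h1 (mob_mem U hZ)] at h
  have h2 := detR_mob U hZ
  have h3 := detR_pos (mob_mem U hZ)
  have h4 : 0 < ‖(den U Z).det‖ := norm_pos_iff.2 (det_den_ne_zero U hZ)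
  refine eq_inv_of_mul_eq_one_left ?_
  have h5 : (‖(blkD U - mob U Z * blkC U).det‖ * ‖(den U Z).det‖) ^ 2 = 1 := by
    rw [← h2] at h
    refine mul_right_cancel₀ h3.ne' ?_
    linear_combination h
  exact (pow_eq_one_iff_of_nonneg (by positivity) two_ne_zero).1 h5

/-- Each of the two factors contributes `|det den|^(-m)` to the complex determinant; the real
determinant is the square of its modulus. -/
theorem abs_det_mobDeriv (U : pseudoUnitary m) {Z : Matrix (Fin m) (Fin m) ℂ}
    (hZ : Z ∈ matrixBall m) :
    |((mobDeriv U Z).restrictScalars ℝ).det| = (‖(den U Z).det‖ ^ (4 * m))⁻¹ := by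
  have h1 : ((mobDeriv U Z).restrictScalars ℝ).det =
      Algebra.norm ℝ (LinearMap.det (mulMul (blkD U - mob U Z * blkC U) (den U Z)⁻¹)) := by
    rw [← LinearMap.det_restrictScalars]
    rfl
  rw [h1, det_mulMul, Algebra.norm_complex_eq]
  change |Complex.normSq _| = _
  rw [abs_of_nonneg (Complex.normSq_nonneg _), Complex.normSq_eq_norm_sq, norm_mul, norm_pow,
    norm_pow, norm_det_deriv U hZ, Matrix.det_nonsing_inv, Ring.inverse_eq_inv', norm_inv]
  rw [← inv_pow]
  ring

/-- The change of variables formula for the fractional linear map of `U`. -/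
theorem lintegral_mob (U : pseudoUnitary m) (F : Matrix (Fin m) (Fin m) ℂ → ENNReal) :
    ∫⁻ Z in matrixBall m, ENNReal.ofReal (‖(den U Z).det‖ ^ (4 * m))⁻¹ * F (mob U Z) =
      ∫⁻ Z in matrixBall m, F Z := by
  have : (volume : Measure (Fin m → Fin m → ℂ)).IsAddHaarMeasure :=
    Measure.pi.isAddHaarMeasure (fun _ : Fin m => (volume : Measure (Fin m → ℂ)))
  have h := lintegral_image_eq_lintegral_abs_det_fderiv_mul (E := Fin m → Fin m → ℂ)
    volume (s := matrixBall m) (f := mob U)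
    (f' := fun Z => (mobDeriv U Z).restrictScalars ℝ) (measurableSet_matrixBall m)
    (fun Z hZ => ((hasFDerivAt_mob U hZ).restrictScalars ℝ).hasFDerivWithinAt) (injOn_mob U) F
  refine Eq.trans ?_ (h.symm.trans (congrArg (fun s => ∫⁻ Z in s, F Z) (image_mob U)))
  refine setLIntegral_congr_fun (measurableSet_matrixBall m) fun Z hZ => ?_
  rw [← abs_det_mobDeriv U hZ]
  rfl

end ColoredConformal

/-! ### The invariant measure on the ball as the image of Haar measure -/

namespace ColoredConformal

variable {m : ℕ}

theorem continuous_detR : Continuous (detR : Matrix (Fin m) (Fin m) ℂ → ℝ) :=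
  Complex.continuous_re.comp (continuous_const.sub
    (continuous_id.matrix_mul continuous_id.matrix_conjTranspose)).matrix_det

/-- The invariant measure `det (1 - Z Z†)^(-2m) |dZ|` on the ball. -/
noncomputable def invMeas (m : ℕ) : Measure (Matrix (Fin m) (Fin m) ℂ) :=
  (volume.restrict (matrixBall m)).withDensity fun Z => ENNReal.ofReal (detR Z ^ (2 * m))⁻¹

theorem measurable_weight : Measurable fun Z : Matrix (Fin m) (Fin m) ℂ =>
    ENNReal.ofReal (detR Z ^ (2 * m))⁻¹ :=
  ((continuous_detR.measurable.pow_const _).inv).ennreal_ofReal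

theorem ae_invMeas_mem : ∀ᵐ Z ∂invMeas m, Z ∈ matrixBall m :=
  (withDensity_absolutelyContinuous _ _).ae_le (ae_restrict_mem (measurableSet_matrixBall m))

instance (m : ℕ) : SigmaFinite (volume : Measure (Matrix (Fin m) (Fin m) ℂ)) :=
  Measure.pi.sigmaFinite (fun _ : Fin m => (volume : Measure (Fin m → ℂ)))

instance : SigmaFinite (invMeas m) :=
  SigmaFinite.withDensity_ofReal _

theorem measurable_mob_comp {X : Type*} [MeasurableSpace X] {f : X → pseudoUnitary m}
    {g : X → Matrix (Fin m) (Fin m) ℂ} (hf : Measurable f) (hg : Measurable g) :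
    Measurable fun x => mob (f x) (g x) := by
  have h : Measurable (fun x => (f x, g x)) := hf.prodMk hg
  have h2 := measurable_mob.comp h
  exact h2

theorem measurable_mob_right (U : pseudoUnitary m) : Measurable (mob U) :=
  measurable_mob_comp measurable_const measurable_id

theorem measurable_mob_left (Z : Matrix (Fin m) (Fin m) ℂ) :
    Measurable fun g : pseudoUnitary m => mob g Z :=
  measurable_mob_comp measurable_id measurable_const

theorem lintegral_invMeas {F : Matrix (Fin m) (Fin m) ℂ → ENNReal} (hF : Measurable F) :
    ∫⁻ Z, F Z ∂invMeas m =
      ∫⁻ Z in matrixBall m, ENNReal.ofReal (detR Z ^ (2 * m))⁻¹ * F Z := by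
  rw [invMeas, lintegral_withDensity_eq_lintegral_mul _ measurable_weight hF]
  rfl

/-- By `detR_mob` the density changes by `|det den|^(4m)`, which cancels the Jacobian. -/
theorem lintegral_invMeas_mob (U : pseudoUnitary m) {F : Matrix (Fin m) (Fin m) ℂ → ENNReal}
    (hF : Measurable F) : ∫⁻ Z, F (mob U Z) ∂invMeas m = ∫⁻ Z, F Z ∂invMeas m := by
  have h := lintegral_invMeas (hF.comp (measurable_mob_right U))
  simp only [Function.comp_apply] at h
  rw [h, lintegral_invMeas hF,
    ← lintegral_mob U (fun Z => ENNReal.ofReal (detR Z ^ (2 * m))⁻¹ * F Z)]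
  refine setLIntegral_congr_fun (measurableSet_matrixBall m) fun Z hZ => ?_
  rw [← mul_assoc, ← ENNReal.ofReal_mul (by positivity), ← detR_mob U hZ, ← mul_inv, mul_pow,
    ← pow_mul]
  ring_nf

theorem exists_mob_zero {Z : Matrix (Fin m) (Fin m) ℂ} (hZ : Z ∈ matrixBall m) :
    ∃ g : pseudoUnitary m, mob g 0 = Z :=
  (exists_hermitian_mob_zero hZ).imp fun _ h => h.2

theorem den_zero (U : pseudoUnitary m) : den U 0 = blkA U := by
  rw [den, Matrix.mul_zero, add_zero]

/-- Here `(1 - Z† Z)⁻¹ = A A†` at `Z = mob g 0`. With `a = tr A†A`, the block relations give `a` for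
`D` and `a - m` for `B` and `C`, in all `4a - 2m`. Hence a bound on this trace cuts out a relatively
compact set of `g`. -/
theorem hsNorm_eq_trace_inv (g : pseudoUnitary m) :
    hsNorm g.1.1 = 4 * ((1 - (mob g 0)ᴴ * mob g 0)⁻¹).trace.re - 2 * m := by
  have h1 := den_mul_one_sub_mob g (zero_mem_matrixBall m)
  rw [den_zero, Matrix.mul_zero, sub_zero] at h1
  have h2 : (1 - (mob g 0)ᴴ * mob g 0)⁻¹ = blkA g * (blkA g)ᴴ := by
    refine Matrix.inv_eq_right_inv ?_
    rw [Matrix.mul_assoc] at h1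
    rw [← Matrix.mul_assoc]
    exact mul_eq_one_comm.1 h1
  obtain ⟨h3, -, h4⟩ := block_relations g
  have h5 := blkA_mul_conjTranspose g
  have h6 := blkD_mul_conjTranspose g
  have t3 := congrArg (fun M => (Matrix.trace M).re) h3
  have t4 := congrArg (fun M => (Matrix.trace M).re) h4
  have t5 := congrArg (fun M => (Matrix.trace M).re) h5
  have t6 := congrArg (fun M => (Matrix.trace M).re) h6
  simp only [Matrix.trace_sub, Complex.sub_re, Matrix.trace_one, Fintype.card_fin,
    Complex.natCast_re] at t3 t4 t5 t6
  rw [h2, hsNorm, val_eq_fromBlocks, Matrix.fromBlocks_conjTranspose, Matrix.fromBlocks_multiply,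
    Matrix.trace, Fintype.sum_sum_type]
  change (Matrix.trace ((blkA g)ᴴ * blkA g + (blkB g)ᴴ * blkB g) +
    Matrix.trace ((blkC g)ᴴ * blkC g + (blkD g)ᴴ * blkD g) : ℂ).re = _
  rw [Matrix.trace_add, Matrix.trace_add]
  simp only [Complex.add_re]
  rw [Matrix.trace_mul_comm (blkA g) (blkA g)ᴴ] at t5 ⊢
  rw [Matrix.trace_mul_comm (blkC g) (blkC g)ᴴ] at t5
  rw [Matrix.trace_mul_comm (blkD g) (blkD g)ᴴ, Matrix.trace_mul_comm (blkB g) (blkB g)ᴴ] at t6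
  linarith

theorem measurable_trace_inv : Measurable fun Z : Matrix (Fin m) (Fin m) ℂ =>
    ((1 - Zᴴ * Z)⁻¹).trace.re := by
  have h0 : Continuous fun Z : Matrix (Fin m) (Fin m) ℂ => 1 - Zᴴ * Z :=
    continuous_const.sub (continuous_id.matrix_conjTranspose.matrix_mul continuous_id)
  have h : (fun Z : Matrix (Fin m) (Fin m) ℂ => ((1 - Zᴴ * Z)⁻¹).trace) =
      fun Z => ((1 - Zᴴ * Z).det)⁻¹ * ((1 - Zᴴ * Z).adjugate).trace := by
    ext Z
    rw [Matrix.inv_def, Ring.inverse_eq_inv', Matrix.trace_smul, smul_eq_mul]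
  refine Complex.measurable_re.comp ?_
  rw [h]
  exact h0.matrix_det.measurable.inv.mul h0.matrix_adjugate.matrix_trace.measurable

/-- By transitivity and right invariance the base point of the orbit map is irrelevant. -/
theorem lintegral_haar_mob (F : Matrix (Fin m) (Fin m) ℂ → ENNReal)
    {Z : Matrix (Fin m) (Fin m) ℂ} (hZ : Z ∈ matrixBall m) :
    ∫⁻ g : pseudoUnitary m, F (mob g Z) ∂Measure.haar =
      ∫⁻ g : pseudoUnitary m, F (mob g 0) ∂Measure.haar := by
  obtain ⟨h, rfl⟩ := exists_mob_zero hZ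
  simp_rw [← mob_mul _ _ (zero_mem_matrixBall m)]
  exact lintegral_mul_right_eq_self (fun g => F (mob g 0)) h

/-- A test set to normalise the proportionality constant. Sublevel sets of the trace exhaust the
space, so one of them has positive measure, and their preimages in the group lie in compact sets
`normLE`. -/
theorem exists_small_set (m : ℕ) : ∃ S : Set (Matrix (Fin m) (Fin m) ℂ), MeasurableSet S ∧
    0 < invMeas m S ∧ invMeas m S < ⊤ ∧
    (Measure.haar : Measure (pseudoUnitary m)) {g | mob g 0 ∈ S} < ⊤ := by
  let T : ℕ → Set (Matrix (Fin m) (Fin m) ℂ) := fun k => {Z | ((1 - Zᴴ * Z)⁻¹).trace.re ≤ k}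
  have hT : ∀ k, MeasurableSet (T k) := fun k => measurableSet_le measurable_trace_inv
    measurable_const
  have hU : ⋃ k, T k = Set.univ := Set.eq_univ_of_forall fun Z => by
    obtain ⟨k, hk⟩ := exists_nat_ge (((1 - Zᴴ * Z)⁻¹).trace.re)
    exact Set.mem_iUnion.2 ⟨k, hk⟩
  have h0 : invMeas m Set.univ ≠ 0 := by
    rw [← lintegral_one, lintegral_invMeas measurable_const]
    intro h
    simp only [mul_one] at h
    rw [lintegral_eq_zero_iff measurable_weight] at h
    have h1 : ∀ᵐ Z ∂volume.restrict (matrixBall m), False := by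
      filter_upwards [h, ae_restrict_mem (measurableSet_matrixBall m)] with Z hZ hZ'
      have := detR_pos hZ'
      simp only [Pi.zero_apply, ENNReal.ofReal_eq_zero] at hZ
      have h2 : 0 < (detR Z ^ (2 * m))⁻¹ := by positivity
      exact absurd hZ (not_le.2 h2)
    rw [Filter.eventually_false_iff_eq_bot, ae_eq_bot, Measure.restrict_eq_zero] at h1
    exact (isOpen_matrixBall m).measure_ne_zero volume ⟨0, zero_mem_matrixBall m⟩ h1
  have h1 : ∃ k, 0 < invMeas m (T k) := by
    by_contra! h
    refine h0 ?_
    rw [← hU]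
    exact measure_iUnion_null fun k => nonpos_iff_eq_zero.1 (h k)
  obtain ⟨k, hk⟩ := h1
  obtain ⟨S, hS, hST, hS0, hS1⟩ := Measure.exists_subset_measure_lt_top (hT k) hk
  refine ⟨S, hS, hS0, hS1, ?_⟩
  refine (measure_mono fun g hg => ?_).trans_lt
    (isCompact_normLE (m := m) (4 * k - 2 * m)).measure_lt_top
  have h2 : ((1 - (mob g 0)ᴴ * mob g 0)⁻¹).trace.re ≤ k := hST hg
  change hsNorm g.1.1 ≤ _
  rw [hsNorm_eq_trace_inv]
  linarith

/-- The image of Haar measure under the orbit map of the origin is a multiple of the invariant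
measure of the ball. -/
theorem exists_lintegral_haar_eq (m : ℕ) : ∃ c : ENNReal, c ≠ ⊤ ∧
    ∀ F : Matrix (Fin m) (Fin m) ℂ → ENNReal, Measurable F →
      ∫⁻ g : pseudoUnitary m, F (mob g 0) ∂Measure.haar = c * ∫⁻ Z, F Z ∂invMeas m := by
  obtain ⟨S, hS, hS0, hS1, hJ⟩ := exists_small_set m
  set μ := (Measure.haar : Measure (pseudoUnitary m))
  set J := μ {g | mob g 0 ∈ S}
  refine ⟨J / invMeas m S, (ENNReal.div_lt_top hJ.ne hS0.ne').ne, fun F hF => ?_⟩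
  set I := ∫⁻ g : pseudoUnitary m, F (mob g 0) ∂μ
  let χ : Matrix (Fin m) (Fin m) ℂ → ENNReal := S.indicator 1
  have hχ : Measurable χ := measurable_one.indicator hS
  have h1 : ∫⁻ g : pseudoUnitary m, χ (mob g 0) ∂μ = J :=
    lintegral_indicator_one (μ := μ) (measurable_mob_left (m := m) 0 hS)
  have m1 : Measurable fun p : Matrix (Fin m) (Fin m) ℂ × pseudoUnitary m =>
      χ p.1 * F (mob p.2 p.1) :=
    (hχ.comp measurable_fst).mul (hF.comp (measurable_mob_comp measurable_snd measurable_fst))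
  have m2 : Measurable fun p : pseudoUnitary m × Matrix (Fin m) (Fin m) ℂ =>
      χ (mob p.1⁻¹ p.2) * F p.2 :=
    (hχ.comp (measurable_mob_comp measurable_fst.inv measurable_snd)).mul (hF.comp measurable_snd)
  -- The double integral of `χ(Z) F(g Z)` is evaluated in both orders. Integrating over `g` first
  -- gives `I` for every `Z`. Moving `g` to `χ` by invariance of `invMeas` and then inverting `g`
  -- gives `J`.
  have key : invMeas m S * I = J * ∫⁻ Z, F Z ∂invMeas m := by
    calc invMeas m S * I = ∫⁻ Z, χ Z * I ∂invMeas m := by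
          rw [lintegral_mul_const _ hχ, lintegral_indicator_one hS]
      _ = ∫⁻ Z, ∫⁻ g : pseudoUnitary m, χ Z * F (mob g Z) ∂μ ∂invMeas m := by
          refine lintegral_congr_ae ?_
          filter_upwards [ae_invMeas_mem] with Z hZ
          have h2 : Measurable fun g : pseudoUnitary m => F (mob g Z) :=
            hF.comp (measurable_mob_left Z)
          rw [lintegral_const_mul _ h2, lintegral_haar_mob F hZ]
      _ = ∫⁻ g : pseudoUnitary m, ∫⁻ Z, χ Z * F (mob g Z) ∂invMeas m ∂μ := by
          exact lintegral_lintegral_swap m1.aemeasurable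
      _ = ∫⁻ g : pseudoUnitary m, ∫⁻ Z, χ (mob g⁻¹ Z) * F Z ∂invMeas m ∂μ := by
          refine lintegral_congr fun g => ?_
          have h2 : Measurable fun Z => χ (mob g⁻¹ Z) * F Z :=
            (hχ.comp (measurable_mob_right g⁻¹)).mul hF
          rw [← lintegral_invMeas_mob g h2]
          refine lintegral_congr_ae ?_
          filter_upwards [ae_invMeas_mem] with Z hZ
          rw [mob_inv_mob g hZ]
      _ = ∫⁻ Z, ∫⁻ g : pseudoUnitary m, χ (mob g⁻¹ Z) * F Z ∂μ ∂invMeas m := by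
          exact lintegral_lintegral_swap m2.aemeasurable
      _ = ∫⁻ Z, J * F Z ∂invMeas m := by
          refine lintegral_congr_ae ?_
          filter_upwards [ae_invMeas_mem] with Z hZ
          have hm : Measurable fun g : pseudoUnitary m => χ (mob g Z) :=
            hχ.comp (measurable_mob_left Z)
          have h3 : Measurable fun g : pseudoUnitary m => χ (mob g⁻¹ Z) := hm.comp measurable_inv
          rw [lintegral_mul_const _ h3,
            lintegral_inv_eq_self (fun g : pseudoUnitary m => χ (mob g Z)) (μ := μ),
            lintegral_haar_mob χ hZ, h1]
      _ = J * ∫⁻ Z, F Z ∂invMeas m := lintegral_const_mul _ hF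
  rw [ENNReal.mul_div_right_comm.symm, ENNReal.eq_div_iff hS0.ne' hS1.ne, key]

end ColoredConformal

/-! ### The representation on the Bergman space -/

namespace ColoredConformal

variable {m : ℕ}

theorem differentiable_det_den (U : pseudoUnitary m) :
    Differentiable ℂ fun Z : Matrix (Fin m) (Fin m) ℂ => (den U Z).det := by
  change Differentiable ℂ (E := Fin m → Fin m → ℂ) fun Z => (den U Z).det
  have h : ∀ i j, Differentiable ℂ (E := Fin m → Fin m → ℂ) fun Z => den U Z i j := by
    intro i j
    have h1 : (fun Z : Fin m → Fin m → ℂ => den U Z i j) =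
        fun Z => blkA U i j + ∑ k, blkC U i k * Z k j := by
      ext Z
      rfl
    rw [h1]
    fun_prop
  simp only [Matrix.det_apply]
  fun_prop

theorem differentiableOn_act (n : ℕ) (U : pseudoUnitary m) {φ : Matrix (Fin m) (Fin m) ℂ → ℂ}
    (hφ : DifferentiableOn ℂ φ (matrixBall m)) :
    DifferentiableOn ℂ (act n U φ) (matrixBall m) := by
  have h1 : DifferentiableOn ℂ (E := Fin m → Fin m → ℂ)
      (fun Z => (den U⁻¹ Z).det ^ (-(n : ℤ))) (matrixBall m) := by
    intro Z hZ
    have h0 : DifferentiableAt ℂ (E := Fin m → Fin m → ℂ) (fun Z => (den U⁻¹ Z).det) Z :=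
      differentiable_det_den U⁻¹ Z
    exact (h0.zpow (Or.inl (det_den_ne_zero U⁻¹ hZ))).differentiableWithinAt
  have h2 : DifferentiableOn ℂ (E := Fin m → Fin m → ℂ) (F := Fin m → Fin m → ℂ)
      (mob U⁻¹) (matrixBall m) := fun Z hZ =>
    (hasFDerivAt_mob U⁻¹ hZ).differentiableAt.differentiableWithinAt
  have h3 : DifferentiableOn ℂ (E := Fin m → Fin m → ℂ)
      (fun Z => φ (mob U⁻¹ Z)) (matrixBall m) :=
    DifferentiableOn.comp (E := Fin m → Fin m → ℂ) (F := Fin m → Fin m → ℂ) (g := φ) hφ h2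
      fun Z hZ => mob_mem U⁻¹ hZ
  have h4 : act n U φ = fun Z => (den U⁻¹ Z).det ^ (-(n : ℤ)) * φ (mob U⁻¹ Z) := by
    ext Z
    rw [act_apply]
  rw [h4]
  exact DifferentiableOn.mul (E := Fin m → Fin m → ℂ) h1 h3

theorem act_congr (n : ℕ) (U : pseudoUnitary m) {φ ψ : Matrix (Fin m) (Fin m) ℂ → ℂ}
    (h : Set.EqOn φ ψ (matrixBall m)) : Set.EqOn (act n U φ) (act n U ψ) (matrixBall m) := by
  intro Z hZ
  rw [act_apply, act_apply, h (mob_mem U⁻¹ hZ)]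

theorem act_add (n : ℕ) (U : pseudoUnitary m) (φ ψ : Matrix (Fin m) (Fin m) ℂ → ℂ) :
    act n U (φ + ψ) = act n U φ + act n U ψ := by
  ext Z
  simp only [act_apply, Pi.add_apply, mul_add]

theorem act_smul (n : ℕ) (U : pseudoUnitary m) (c : ℂ) (φ : Matrix (Fin m) (Fin m) ℂ → ℂ) :
    act n U (c • φ) = c • act n U φ := by
  ext Z
  simp only [act_apply, Pi.smul_apply, smul_eq_mul, mul_left_comm]

variable {N n : ℕ}

theorem cConst_pos (N n : ℕ) : 0 < cConst N n := by
  unfold cConst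
  have := Real.pi_pos
  positivity

theorem measurable_ballDensity : Measurable fun Z : Matrix (Fin (2 * N)) (Fin (2 * N)) ℂ =>
    ENNReal.ofReal (cConst N n * detR Z ^ (n - 4 * N)) :=
  ((continuous_detR.measurable.pow_const _).const_mul _).ennreal_ofReal

theorem lintegral_ballMeasure (F : Matrix (Fin (2 * N)) (Fin (2 * N)) ℂ → ENNReal) :
    ∫⁻ Z, F Z ∂ballMeasure N n = ∫⁻ Z in matrixBall (2 * N),
      ENNReal.ofReal (cConst N n * detR Z ^ (n - 4 * N)) * F Z := by
  have h := lintegral_withDensity_eq_lintegral_mul_non_measurable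
    (volume.restrict (matrixBall (2 * N))) (measurable_ballDensity (N := N) (n := n))
    (Filter.Eventually.of_forall fun _ => ENNReal.ofReal_lt_top) F
  exact h

theorem ballMeasure_absolutelyContinuous (N n : ℕ) :
    ballMeasure N n ≪ volume.restrict (matrixBall (2 * N)) :=
  withDensity_absolutelyContinuous _ _

theorem absolutelyContinuous_ballMeasure (N n : ℕ) :
    volume.restrict (matrixBall (2 * N)) ≪ ballMeasure N n := by
  refine withDensity_absolutelyContinuous' measurable_ballDensity.aemeasurable ?_
  filter_upwards [ae_restrict_mem (measurableSet_matrixBall _)] with Z hZ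
  have h1 := detR_pos hZ
  have h2 := cConst_pos N n
  have h3 : 0 < cConst N n * detR Z ^ (n - 4 * N) := by positivity
  exact (ENNReal.ofReal_pos.2 h3).ne'

theorem ae_ballMeasure_mem (N n : ℕ) : ∀ᵐ Z ∂ballMeasure N n, Z ∈ matrixBall (2 * N) :=
  (ballMeasure_absolutelyContinuous N n).ae_le (ae_restrict_mem (measurableSet_matrixBall _))

theorem ae_eq_of_eqOn {φ ψ : Matrix (Fin (2 * N)) (Fin (2 * N)) ℂ → ℂ}
    (h : Set.EqOn φ ψ (matrixBall (2 * N))) : φ =ᵐ[ballMeasure N n] ψ := by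
  filter_upwards [ae_ballMeasure_mem N n] with Z hZ using h hZ

/-- The exponent is a natural number, so the density is bounded on the compact polydisc around the
ball. Thus constants are square-integrable. -/
instance (N n : ℕ) : IsFiniteMeasure (ballMeasure N n) where
  measure_univ_lt_top := by
    let K : Set (Matrix (Fin (2 * N)) (Fin (2 * N)) ℂ) :=
      Set.univ.pi fun _ => Set.univ.pi fun _ => Metric.closedBall (0 : ℂ) 1
    have hK : IsCompact K := isCompact_univ_pi fun _ => isCompact_univ_pi fun _ =>
      isCompact_closedBall _ _
    have hc : Continuous fun Z : Matrix (Fin (2 * N)) (Fin (2 * N)) ℂ =>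
      cConst N n * detR Z ^ (n - 4 * N) := continuous_const.mul (continuous_detR.pow _)
    obtain ⟨C, hC⟩ := hK.exists_bound_of_continuousOn hc.continuousOn
    rw [← lintegral_one, lintegral_ballMeasure]
    calc _ ≤ ∫⁻ _ in matrixBall (2 * N), ENNReal.ofReal C := by
          refine setLIntegral_mono measurable_const fun Z hZ => ?_
          rw [mul_one]
          refine ENNReal.ofReal_le_ofReal ((le_abs_self _).trans (hC Z fun i _ j _ => ?_))
          rw [mem_closedBall_zero_iff]
          exact norm_apply_le_of_mem_matrixBall hZ i j
      _ < ⊤ := by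
          rw [setLIntegral_const]
          exact ENNReal.mul_lt_top ENNReal.ofReal_lt_top (volume_matrixBall_lt_top _)

theorem aestronglyMeasurable_of_differentiableOn
    {φ : Matrix (Fin (2 * N)) (Fin (2 * N)) ℂ → ℂ}
    (hφ : DifferentiableOn ℂ φ (matrixBall (2 * N))) :
    AEStronglyMeasurable φ (ballMeasure N n) :=
  (hφ.continuousOn.aestronglyMeasurable (measurableSet_matrixBall _)).mono_ac
    (ballMeasure_absolutelyContinuous N n)

/-- The density is positive on the open ball, where both functions are continuous. This makes the
values of `rep` on the ball independent of choices. -/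
theorem eqOn_of_ae_eq {φ ψ : Matrix (Fin (2 * N)) (Fin (2 * N)) ℂ → ℂ}
    (hφ : DifferentiableOn ℂ φ (matrixBall (2 * N)))
    (hψ : DifferentiableOn ℂ ψ (matrixBall (2 * N))) (h : φ =ᵐ[ballMeasure N n] ψ) :
    Set.EqOn φ ψ (matrixBall (2 * N)) :=
  Measure.eqOn_open_of_ae_eq ((absolutelyContinuous_ballMeasure N n).ae_le h)
    (isOpen_matrixBall _) hφ.continuousOn hψ.continuousOn

/-- The action of `U(2N, 2N)` preserves square integrals. -/
theorem lintegral_act (hn : 4 * N ≤ n) (U : pseudoUnitary (2 * N))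
    (φ : Matrix (Fin (2 * N)) (Fin (2 * N)) ℂ → ℂ) :
    ∫⁻ Z, ‖act n U φ Z‖ₑ ^ 2 ∂ballMeasure N n = ∫⁻ Z, ‖φ Z‖ₑ ^ 2 ∂ballMeasure N n := by
  rw [lintegral_ballMeasure, lintegral_ballMeasure, ← lintegral_mob U⁻¹
    (fun Z => ENNReal.ofReal (cConst N n * detR Z ^ (n - 4 * N)) * ‖φ Z‖ₑ ^ 2)]
  refine setLIntegral_congr_fun (measurableSet_matrixBall _) fun Z hZ => ?_
  have hd : 0 < ‖(den U⁻¹ Z).det‖ := norm_pos_iff.2 (det_den_ne_zero U⁻¹ hZ)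
  have hc := cConst_pos N n
  have h1 := detR_pos (mob_mem U⁻¹ hZ)
  simp only [act_apply]
  rw [enorm_mul, mul_pow, ← mul_assoc, ← mul_assoc]
  congr 1
  rw [← ofReal_norm, ← ENNReal.ofReal_pow (norm_nonneg _), ← ENNReal.ofReal_mul
    (mul_nonneg hc.le (pow_nonneg (detR_pos hZ).le _)), ← ENNReal.ofReal_mul (by positivity)]
  congr 1
  -- With `n = 4N + k`, the power of `|det den|` is `2k` from the density and `-2n` from `act`; the
  -- sum `-8N` is the Jacobian exponent `-4m` for `m = 2N`.
  rw [← detR_mob U⁻¹ hZ, norm_zpow, zpow_neg, zpow_natCast]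
  obtain ⟨k, rfl⟩ := Nat.exists_eq_add_of_le hn
  rw [Nat.add_sub_cancel_left]
  field_simp
  ring

theorem eLpNorm_act (hn : 4 * N ≤ n) (U : pseudoUnitary (2 * N))
    (φ : Matrix (Fin (2 * N)) (Fin (2 * N)) ℂ → ℂ) :
    eLpNorm (act n U φ) 2 (ballMeasure N n) = eLpNorm φ 2 (ballMeasure N n) := by
  rw [eLpNorm_eq_lintegral_rpow_enorm_toReal two_ne_zero ENNReal.ofNat_ne_top,
    eLpNorm_eq_lintegral_rpow_enorm_toReal two_ne_zero ENNReal.ofNat_ne_top]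
  have h := lintegral_act hn U φ
  simp only [ENNReal.toReal_ofNat, ENNReal.rpow_ofNat, h]

theorem memLp_act (hn : 4 * N ≤ n) (U : pseudoUnitary (2 * N))
    {φ : Matrix (Fin (2 * N)) (Fin (2 * N)) ℂ → ℂ}
    (hφ : DifferentiableOn ℂ φ (matrixBall (2 * N))) (h : MemLp φ 2 (ballMeasure N n)) :
    MemLp (act n U φ) 2 (ballMeasure N n) :=
  ⟨aestronglyMeasurable_of_differentiableOn (differentiableOn_act n U hφ),
    (eLpNorm_act hn U φ).trans_lt h.2⟩

/-- The holomorphic representative of an element of the Bergman space. -/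
noncomputable def rep (f : bergman N n) : Matrix (Fin (2 * N)) (Fin (2 * N)) ℂ → ℂ :=
  Classical.choose f.2

theorem differentiableOn_rep (f : bergman N n) :
    DifferentiableOn ℂ (rep f) (matrixBall (2 * N)) :=
  (Classical.choose_spec f.2).1

theorem coe_ae_eq_rep (f : bergman N n) :
    (f : Lp ℂ 2 (ballMeasure N n)) =ᵐ[ballMeasure N n] rep f :=
  (Classical.choose_spec f.2).2

theorem memLp_rep (f : bergman N n) : MemLp (rep f) 2 (ballMeasure N n) :=
  (Lp.memLp (f : Lp ℂ 2 (ballMeasure N n))).ae_eq (coe_ae_eq_rep f)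

/-- The element of the Bergman space given by a square-integrable holomorphic function. -/
noncomputable def bergmanMk (φ : Matrix (Fin (2 * N)) (Fin (2 * N)) ℂ → ℂ)
    (hφ : DifferentiableOn ℂ φ (matrixBall (2 * N))) (h : MemLp φ 2 (ballMeasure N n)) :
    bergman N n :=
  ⟨h.toLp φ, φ, hφ, h.coeFn_toLp⟩

theorem coe_bergmanMk (φ : Matrix (Fin (2 * N)) (Fin (2 * N)) ℂ → ℂ)
    (hφ : DifferentiableOn ℂ φ (matrixBall (2 * N))) (h : MemLp φ 2 (ballMeasure N n)) :
    (bergmanMk φ hφ h : Lp ℂ 2 (ballMeasure N n)) =ᵐ[ballMeasure N n] φ :=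
  h.coeFn_toLp

theorem rep_eqOn {f : bergman N n} {φ : Matrix (Fin (2 * N)) (Fin (2 * N)) ℂ → ℂ}
    (hφ : DifferentiableOn ℂ φ (matrixBall (2 * N)))
    (h : (f : Lp ℂ 2 (ballMeasure N n)) =ᵐ[ballMeasure N n] φ) :
    Set.EqOn (rep f) φ (matrixBall (2 * N)) :=
  eqOn_of_ae_eq (n := n) (differentiableOn_rep f) hφ ((coe_ae_eq_rep f).symm.trans h)

theorem ext_rep {f g : bergman N n} (h : Set.EqOn (rep f) (rep g) (matrixBall (2 * N))) : f = g :=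
  Subtype.ext (Lp.ext ((coe_ae_eq_rep f).trans ((ae_eq_of_eqOn h).trans (coe_ae_eq_rep g).symm)))

theorem rep_add (f g : bergman N n) :
    Set.EqOn (rep (f + g)) (rep f + rep g) (matrixBall (2 * N)) := by
  refine rep_eqOn (DifferentiableOn.add (E := Fin (2 * N) → Fin (2 * N) → ℂ)
    (differentiableOn_rep f) (differentiableOn_rep g)) ?_
  exact (Lp.coeFn_add _ _).trans ((coe_ae_eq_rep f).add (coe_ae_eq_rep g))

theorem rep_smul (c : ℂ) (f : bergman N n) :
    Set.EqOn (rep (c • f)) (c • rep f) (matrixBall (2 * N)) := by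
  refine rep_eqOn (DifferentiableOn.const_smul (E := Fin (2 * N) → Fin (2 * N) → ℂ)
    (differentiableOn_rep f) c) ?_
  exact (Lp.coeFn_smul _ _).trans ((coe_ae_eq_rep f).const_smul c)

theorem norm_eq_eLpNorm_rep (f : bergman N n) :
    ‖f‖ = (eLpNorm (rep f) 2 (ballMeasure N n)).toReal := by
  rw [← eLpNorm_congr_ae (coe_ae_eq_rep f)]
  rfl

theorem rep_bergmanMk (φ : Matrix (Fin (2 * N)) (Fin (2 * N)) ℂ → ℂ)
    (hφ : DifferentiableOn ℂ φ (matrixBall (2 * N))) (h : MemLp φ 2 (ballMeasure N n)) :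
    Set.EqOn (rep (bergmanMk φ hφ h)) φ (matrixBall (2 * N)) :=
  rep_eqOn hφ (coe_bergmanMk φ hφ h)

/-- The operator of `U` on the Bergman space. -/
noncomputable def actBergman (hn : 4 * N ≤ n) (U : pseudoUnitary (2 * N)) (f : bergman N n) :
    bergman N n :=
  bergmanMk (act n U (rep f)) (differentiableOn_act n U (differentiableOn_rep f))
    (memLp_act hn U (differentiableOn_rep f) (memLp_rep f))

theorem rep_actBergman (hn : 4 * N ≤ n) (U : pseudoUnitary (2 * N)) (f : bergman N n) :
    Set.EqOn (rep (actBergman hn U f)) (act n U (rep f)) (matrixBall (2 * N)) :=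
  rep_bergmanMk _ _ _

theorem actBergman_mul (hn : 4 * N ≤ n) (U V : pseudoUnitary (2 * N)) (f : bergman N n) :
    actBergman hn (U * V) f = actBergman hn U (actBergman hn V f) :=
  ext_rep fun Z hZ => by
    rw [rep_actBergman hn _ _ hZ, act_mul n U V _ hZ, rep_actBergman hn _ _ hZ]
    exact (act_congr n U (rep_actBergman hn V f) hZ).symm

theorem actBergman_one (hn : 4 * N ≤ n) (f : bergman N n) : actBergman hn 1 f = f :=
  ext_rep fun Z hZ => by rw [rep_actBergman hn _ _ hZ, act_one]

theorem norm_actBergman (hn : 4 * N ≤ n) (U : pseudoUnitary (2 * N)) (f : bergman N n) :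
    ‖actBergman hn U f‖ = ‖f‖ := by
  rw [norm_eq_eLpNorm_rep, norm_eq_eLpNorm_rep,
    eLpNorm_congr_ae (ae_eq_of_eqOn (rep_actBergman hn U f)), eLpNorm_act hn]

/-- The representation of `U(2N, 2N)` on the Bergman space. -/
noncomputable def bergmanRepr (hn : 4 * N ≤ n) :
    pseudoUnitary (2 * N) →* (bergman N n ≃ₗᵢ[ℂ] bergman N n) where
  toFun U :=
    { toFun := actBergman hn U
      map_add' := fun f g => ext_rep fun Z hZ => by
        rw [rep_actBergman hn _ _ hZ, rep_add _ _ hZ, act_congr n U (rep_add f g) hZ, act_add,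
          Pi.add_apply, Pi.add_apply, rep_actBergman hn _ _ hZ, rep_actBergman hn _ _ hZ]
      map_smul' := fun c f => ext_rep fun Z hZ => by
        rw [rep_actBergman hn _ _ hZ, RingHom.id_apply, rep_smul _ _ hZ,
          act_congr n U (rep_smul c f) hZ, act_smul, Pi.smul_apply, Pi.smul_apply,
          rep_actBergman hn _ _ hZ]
      invFun := actBergman hn U⁻¹
      left_inv := fun f => by rw [← actBergman_mul, inv_mul_cancel, actBergman_one]
      right_inv := fun f => by rw [← actBergman_mul, mul_inv_cancel, actBergman_one]
      norm_map' := norm_actBergman hn U }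
  map_one' := LinearIsometryEquiv.ext (actBergman_one hn)
  map_mul' U V := LinearIsometryEquiv.ext (actBergman_mul hn U V)

theorem rep_bergmanRepr (hn : 4 * N ≤ n) (U : pseudoUnitary (2 * N)) (f : bergman N n) :
    Set.EqOn (rep (bergmanRepr hn U f)) (act n U (rep f)) (matrixBall (2 * N)) :=
  rep_actBergman hn U f

theorem bergmanRepr_spec (hn : 4 * N ≤ n) (U : pseudoUnitary (2 * N)) (f : bergman N n)
    (φ : Matrix (Fin (2 * N)) (Fin (2 * N)) ℂ → ℂ)
    (hφ : DifferentiableOn ℂ φ (matrixBall (2 * N)))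
    (h : (f : Lp ℂ 2 (ballMeasure N n)) =ᵐ[ballMeasure N n] φ) :
    DifferentiableOn ℂ (act n U φ) (matrixBall (2 * N)) ∧
      (bergmanRepr hn U f : Lp ℂ 2 (ballMeasure N n)) =ᵐ[ballMeasure N n] act n U φ := by
  refine ⟨differentiableOn_act n U hφ, (coe_ae_eq_rep _).trans (ae_eq_of_eqOn ?_)⟩
  exact (rep_bergmanRepr hn U f).trans (act_congr n U (rep_eqOn hφ h))

end ColoredConformal

/-! ### Averaging over the circle and the mean value property -/

theorem ENNReal.mul_le_sq_add_sq (a b : ENNReal) : a * b ≤ a ^ 2 + b ^ 2 := by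
  rcases le_total a b with h | h
  · exact (mul_le_mul_left h b).trans ((pow_two b).symm.le.trans le_add_self)
  · exact (mul_le_mul_right h a).trans ((pow_two a).symm.le.trans le_self_add)

/-- Interchange of an integral over a compact interval with the inner product of square-integrable
functions. -/
theorem MeasureTheory.intervalIntegral_integral_conj_mul_swap {X : Type*} [MeasurableSpace X]
    (μ : Measure X) [SFinite μ] {a : X → ℂ} {b : ℝ → X → ℂ} (ha : Measurable a)
    (hb : Measurable (Function.uncurry b)) {A B : ENNReal} (hA : A ≠ ⊤) (hB : B ≠ ⊤)
    (ha2 : ∫⁻ x, ‖a x‖ₑ ^ 2 ∂μ ≤ A) (hb2 : ∀ θ, ∫⁻ x, ‖b θ x‖ₑ ^ 2 ∂μ ≤ B) (T : ℝ) (hT : 0 ≤ T) :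
    ∫ θ in (0 : ℝ)..T, ∫ x, starRingEnd ℂ (a x) * b θ x ∂μ =
      ∫ x, starRingEnd ℂ (a x) * (∫ θ in (0 : ℝ)..T, b θ x) ∂μ := by
  simp only [intervalIntegral.integral_of_le hT]
  have hm : Measurable (Function.uncurry fun θ x => starRingEnd ℂ (a x) * b θ x) :=
    ((Complex.continuous_conj.measurable.comp ha).comp measurable_snd).mul hb
  have hi : Integrable (Function.uncurry fun θ x => starRingEnd ℂ (a x) * b θ x)
      ((volume.restrict (Set.Ioc 0 T)).prod μ) := by
    refine ⟨hm.aestronglyMeasurable, ?_⟩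
    rw [HasFiniteIntegral, lintegral_prod _ hm.enorm.aemeasurable]
    -- Joint integrability: the inner integral is bounded uniformly in `θ`, and the interval is
    -- finite.
    calc _ ≤ ∫⁻ _ in Set.Ioc (0 : ℝ) T, (A + B) := by
          refine lintegral_mono fun θ => ?_
          calc _ ≤ ∫⁻ x, (‖a x‖ₑ ^ 2 + ‖b θ x‖ₑ ^ 2) ∂μ := by
                refine lintegral_mono fun x => ?_
                simp only [Function.uncurry_apply_pair]
                rw [enorm_mul, RCLike.enorm_conj]
                exact ENNReal.mul_le_sq_add_sq _ _
            _ = ∫⁻ x, ‖a x‖ₑ ^ 2 ∂μ + ∫⁻ x, ‖b θ x‖ₑ ^ 2 ∂μ :=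
                lintegral_add_left (ha.enorm.pow_const 2) _
            _ ≤ A + B := add_le_add ha2 (hb2 θ)
      _ < ⊤ := by
          rw [setLIntegral_const]
          exact ENNReal.mul_lt_top (ENNReal.add_lt_top.2 ⟨hA.lt_top, hB.lt_top⟩)
            measure_Ioc_lt_top
  rw [integral_integral_swap hi]
  refine integral_congr_ae (Filter.Eventually.of_forall fun x => ?_)
  simp only
  rw [integral_const_mul]

namespace ColoredConformal

variable {m N n : ℕ}

/-- The diagonal element of `U(m, m)` that acts on the ball by the rotation `Z ↦ e^{-iθ} Z`; its
inverse acts by `Z ↦ e^{iθ} Z`. -/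
noncomputable def rotElt (m : ℕ) (θ : ℝ) : pseudoUnitary m :=
  ofMatrix (Matrix.fromBlocks 1 0 0 (Complex.exp (-(θ * Complex.I)) • 1)) (by
    have h : Complex.exp (-(θ * Complex.I)) * starRingEnd ℂ (Complex.exp (-(θ * Complex.I))) =
        1 := by
      rw [← Complex.exp_conj, ← Complex.exp_add]
      simp
    simp [Matrix.fromBlocks_conjTranspose, Gam, Matrix.fromBlocks_multiply,
      Matrix.conjTranspose_smul, smul_smul, h])

theorem continuous_rotElt (m : ℕ) : Continuous (rotElt m) := by
  refine continuous_ofMatrix (f := fun θ : ℝ => Matrix.fromBlocks 1 0 0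
    (Complex.exp (-(θ * Complex.I)) • (1 : Matrix (Fin m) (Fin m) ℂ))) ?_ _
  refine Continuous.matrix_fromBlocks continuous_const continuous_const continuous_const ?_
  have h : Continuous fun θ : ℝ => Complex.exp (-(θ * Complex.I)) := by fun_prop
  exact h.smul continuous_const

theorem blkA_rotElt (θ : ℝ) : blkA (rotElt m θ) = 1 :=
  Matrix.toBlocks_fromBlocks₁₁ _ _ _ _

theorem blkB_rotElt (θ : ℝ) : blkB (rotElt m θ) = 0 :=
  Matrix.toBlocks_fromBlocks₂₁ _ _ _ _

theorem blkC_rotElt (θ : ℝ) : blkC (rotElt m θ) = 0 :=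
  Matrix.toBlocks_fromBlocks₁₂ _ _ _ _

theorem blkD_rotElt (θ : ℝ) : blkD (rotElt m θ) = Complex.exp (-(θ * Complex.I)) • 1 :=
  Matrix.toBlocks_fromBlocks₂₂ _ _ _ _

theorem mob_rotElt_inv (θ : ℝ) (Z : Matrix (Fin m) (Fin m) ℂ) :
    mob (rotElt m θ)⁻¹ Z = Complex.exp (θ * Complex.I) • Z := by
  have h : starRingEnd ℂ (Complex.exp (-(θ * Complex.I))) = Complex.exp (θ * Complex.I) := by
    rw [← Complex.exp_conj]
    simp
  simp [mob, num, den, blkA_inv, blkB_inv, blkC_inv, blkD_inv, blkA_rotElt, blkB_rotElt,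
    blkC_rotElt, blkD_rotElt, Matrix.conjTranspose_smul, h]

theorem det_den_rotElt_inv (θ : ℝ) (Z : Matrix (Fin m) (Fin m) ℂ) :
    (den (rotElt m θ)⁻¹ Z).det = 1 := by
  simp [den, blkA_inv, blkC_inv, blkA_rotElt, blkB_rotElt]

theorem act_rotElt (θ : ℝ) (φ : Matrix (Fin m) (Fin m) ℂ → ℂ) (Z : Matrix (Fin m) (Fin m) ℂ) :
    act n (rotElt m θ) φ Z = φ (Complex.exp (θ * Complex.I) • Z) := by
  rw [act_apply, det_den_rotElt_inv, mob_rotElt_inv, one_zpow, one_mul]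

/-- The mean value property over the circle through `Z`. -/
theorem intervalIntegral_rotate {φ : Matrix (Fin m) (Fin m) ℂ → ℂ}
    (hφ : DifferentiableOn ℂ φ (matrixBall m)) {Z : Matrix (Fin m) (Fin m) ℂ}
    (hZ : Z ∈ matrixBall m) :
    ∫ θ in (0 : ℝ)..2 * Real.pi, φ (Complex.exp (θ * Complex.I) • Z) = 2 * Real.pi * φ 0 := by
  have h1 : DifferentiableOn ℂ (fun t : ℂ => φ (t • Z)) (Metric.closedBall 0 1) := by
    refine DifferentiableOn.comp (F := Fin m → Fin m → ℂ) (g := φ) (f := fun t : ℂ => t • Z)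
      (t := matrixBall m) hφ ?_ ?_
    · exact (differentiable_id.smul_const (F := Fin m → Fin m → ℂ) Z).differentiableOn
    · intro t ht
      exact smul_mem_matrixBall hZ (mem_closedBall_zero_iff.1 ht)
  -- The one-variable mean value property on the closed unit disc, which `t ↦ t Z` maps into the
  -- ball.
  have h2 : Real.circleAverage (fun t : ℂ => φ (t • Z)) 0 1 = φ ((0 : ℂ) • Z) := by
    refine DiffContOnCl.circleAverage ?_
    rw [abs_one]
    exact (h1.mono Metric.closure_ball_subset_closedBall).diffContOnCl
  rw [Real.circleAverage_def, zero_smul] at h2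
  simp only [circleMap, Complex.ofReal_one, one_mul, zero_add] at h2
  rw [← h2, Complex.real_smul]
  have := Real.pi_ne_zero
  rw [← mul_assoc, ← Complex.ofReal_ofNat, ← Complex.ofReal_mul, ← Complex.ofReal_mul,
    mul_inv_cancel₀ (by positivity), Complex.ofReal_one, one_mul]

noncomputable instance (N n : ℕ) : Inner ℂ (bergman N n) :=
  (inferInstance : InnerProductSpace ℂ (bergman N n)).toInner

theorem inner_eq_integral (f g : bergman N n) :
    inner ℂ f g = ∫ Z, starRingEnd ℂ (rep f Z) * rep g Z ∂ballMeasure N n := by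
  change inner ℂ (f : Lp ℂ 2 (ballMeasure N n)) (g : Lp ℂ 2 (ballMeasure N n)) = _
  rw [L2.inner_def]
  refine integral_congr_ae ?_
  filter_upwards [coe_ae_eq_rep f, coe_ae_eq_rep g] with Z h1 h2
  rw [h1, h2, RCLike.inner_apply, mul_comm]

theorem lintegral_rep_lt_top (f : bergman N n) :
    ∫⁻ Z, ‖rep f Z‖ₑ ^ 2 ∂ballMeasure N n < ⊤ := by
  have h := (memLp_rep f).2
  rw [eLpNorm_lt_top_iff_lintegral_rpow_enorm_lt_top two_ne_zero ENNReal.ofNat_ne_top] at h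
  simpa using h

theorem lintegral_rep_eq (f : bergman N n) :
    ∫⁻ Z, ‖rep f Z‖ₑ ^ 2 ∂ballMeasure N n = ENNReal.ofReal (‖f‖ ^ 2) := by
  have h := norm_eq_eLpNorm_rep f
  rw [eLpNorm_eq_lintegral_rpow_enorm_toReal two_ne_zero ENNReal.ofNat_ne_top] at h
  simp only [ENNReal.toReal_ofNat, ENNReal.rpow_ofNat] at h
  rw [h, ← ENNReal.toReal_pow, ← ENNReal.rpow_natCast, ← ENNReal.rpow_mul]
  simp [ENNReal.ofReal_toReal (lintegral_rep_lt_top f).ne]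

/-- The constant function `1`. -/
noncomputable def bergmanOne (N n : ℕ) : bergman N n :=
  bergmanMk (fun _ => 1) (differentiableOn_const 1) (memLp_const 1)

theorem rep_bergmanOne : Set.EqOn (rep (bergmanOne N n)) (fun _ => 1) (matrixBall (2 * N)) :=
  rep_bergmanMk _ _ _

theorem bergmanRepr_rotElt_one (hn : 4 * N ≤ n) (θ : ℝ) :
    bergmanRepr hn (rotElt (2 * N) θ) (bergmanOne N n) = bergmanOne N n :=
  ext_rep fun Z hZ => by
    rw [rep_bergmanRepr hn _ _ hZ, act_rotElt, rep_bergmanOne hZ, rep_bergmanOne]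
    exact smul_mem_matrixBall hZ (by rw [Complex.norm_exp_ofReal_mul_I])

theorem bergmanOne_ne_zero (N n : ℕ) : bergmanOne N n ≠ 0 := by
  intro h
  have h1 := rep_bergmanOne (n := n) (zero_mem_matrixBall (2 * N))
  have h2 := rep_smul 0 (bergmanOne N n) (zero_mem_matrixBall (2 * N))
  rw [zero_smul, ← h, h1] at h2
  simp at h2

/-- After Fubini, the mean value property replaces `u(e^{iθ} Z)` by `u(0)` for each `Z`: the
averaged operator is `u ↦ u(0) · 1`. -/
theorem integral_inner_rotElt (hn : 4 * N ≤ n) (v u : bergman N n) :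
    ∫ θ in (0 : ℝ)..2 * Real.pi, inner ℂ v (bergmanRepr hn (rotElt (2 * N) θ) u) =
      2 * Real.pi * (inner ℂ v (bergmanOne N n) * rep u 0) := by
  classical
  let D := matrixBall (2 * N)
  have hD : MeasurableSet D := measurableSet_matrixBall _
  -- Representatives are arbitrary off the ball; cutting them off there makes them measurable.
  let a := D.indicator (rep v)
  let u' := D.indicator (rep u)
  have hmeas : ∀ f : bergman N n, Measurable (D.indicator (rep f)) := by
    intro f
    rw [← Set.piecewise_eq_indicator]
    exact (differentiableOn_rep f).continuousOn.measurable_piecewise continuousOn_const hD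
  let b : ℝ → Matrix (Fin (2 * N)) (Fin (2 * N)) ℂ → ℂ := fun θ Z =>
    u' (Complex.exp (θ * Complex.I) • Z)
  have hb : Measurable (Function.uncurry b) := by
    refine (hmeas u).comp ?_
    have : Continuous fun p : ℝ × Matrix (Fin (2 * N)) (Fin (2 * N)) ℂ =>
      Complex.exp (p.1 * Complex.I) • p.2 := by fun_prop
    exact this.measurable
  have hrot : ∀ (θ : ℝ) {Z}, Z ∈ D → Complex.exp (θ * Complex.I) • Z ∈ D := fun θ Z hZ =>
    smul_mem_matrixBall hZ (by rw [Complex.norm_exp_ofReal_mul_I])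
  have h1 : ∀ θ : ℝ, inner ℂ v (bergmanRepr hn (rotElt (2 * N) θ) u) =
      ∫ Z, starRingEnd ℂ (a Z) * b θ Z ∂ballMeasure N n := by
    intro θ
    rw [inner_eq_integral]
    refine integral_congr_ae ?_
    filter_upwards [ae_ballMeasure_mem N n] with Z hZ
    rw [rep_bergmanRepr hn _ _ hZ, act_rotElt]
    simp only [a, b, u']
    rw [Set.indicator_of_mem hZ, Set.indicator_of_mem (hrot θ hZ)]
  have ha2 : ∫⁻ Z, ‖a Z‖ₑ ^ 2 ∂ballMeasure N n ≤ ENNReal.ofReal (‖v‖ ^ 2) := by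
    rw [← lintegral_rep_eq]
    refine lintegral_mono fun Z => ?_
    gcongr
    exact enorm_indicator_le_enorm_self (rep v) _
  have hb2 : ∀ θ, ∫⁻ Z, ‖b θ Z‖ₑ ^ 2 ∂ballMeasure N n ≤ ENNReal.ofReal (‖u‖ ^ 2) := by
    intro θ
    rw [← lintegral_rep_eq, ← lintegral_act hn (rotElt (2 * N) θ) (rep u)]
    refine lintegral_mono fun Z => ?_
    rw [act_rotElt]
    gcongr
    exact enorm_indicator_le_enorm_self (rep u) _
  simp only [h1]
  rw [intervalIntegral_integral_conj_mul_swap _ (hmeas v) hb ENNReal.ofReal_ne_top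
    ENNReal.ofReal_ne_top ha2 hb2 _ (by positivity), inner_eq_integral, ← integral_mul_const,
    ← integral_const_mul]
  refine integral_congr_ae ?_
  filter_upwards [ae_ballMeasure_mem N n] with Z hZ
  have h2 : ∀ θ : ℝ, b θ Z = rep u (Complex.exp (θ * Complex.I) • Z) := fun θ =>
    Set.indicator_of_mem (hrot θ hZ) _
  simp only [h2, intervalIntegral_rotate (differentiableOn_rep u) hZ, rep_bergmanOne hZ]
  rw [Set.indicator_of_mem (show Z ∈ D from hZ)]
  ring

/-- For `v = 1` the averaged integrand is constant, as rotations are unitary and fix `1`. So `1`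
represents evaluation at the origin up to a factor. -/
theorem rep_zero_mul (hn : 4 * N ≤ n) (u : bergman N n) :
    inner ℂ (bergmanOne N n) (bergmanOne N n) * rep u 0 = inner ℂ (bergmanOne N n) u := by
  have h := integral_inner_rotElt hn (bergmanOne N n) u
  have h1 : ∀ θ : ℝ, inner ℂ (bergmanOne N n) (bergmanRepr hn (rotElt (2 * N) θ) u) =
      inner ℂ (bergmanOne N n) u := fun θ => by
    conv_lhs => rw [← bergmanRepr_rotElt_one hn θ]
    exact LinearIsometryEquiv.inner_map_map _ _ _
  simp only [h1, intervalIntegral.integral_const, sub_zero, Complex.real_smul] at h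
  push_cast at h
  have h2 : (2 * Real.pi : ℂ) ≠ 0 := by
    exact_mod_cast (by positivity : (2 * Real.pi : ℝ) ≠ 0)
  exact (mul_left_cancel₀ h2 h).symm

end ColoredConformal

/-! ### Bounded point evaluations and completeness -/

/-- A locally uniform limit of holomorphic functions of several variables is holomorphic. -/
theorem differentiableOn_of_uniformCauchySeqOn {E : Type*} [NormedAddCommGroup E] [NormedSpace ℂ E]
    {s : Set E} {F : ℕ → E → ℂ} {f : E → ℂ}
    (hF : ∀ k, DifferentiableOn ℂ (F k) s)
    (hf : ∀ x ∈ s, Filter.Tendsto (fun k => F k x) Filter.atTop (nhds (f x)))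
    (hc : ∀ x ∈ s, ∃ r > 0, Metric.ball x r ⊆ s ∧
      UniformCauchySeqOn F Filter.atTop (Metric.ball x r)) : DifferentiableOn ℂ f s := by
  intro x hx
  obtain ⟨r, hr, hrs, hu⟩ := hc x hx
  have hd : ∀ k, ∀ y ∈ Metric.ball x r, HasFDerivAt (F k) (fderiv ℂ (F k) y) y := fun k y hy =>
    (((hF k).mono hrs).differentiableAt (Metric.isOpen_ball.mem_nhds hy)).hasFDerivAt
  have hu' : UniformCauchySeqOn (fun k => fderiv ℂ (F k)) Filter.atTop (Metric.ball x (r / 2)) := by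
    rw [Metric.uniformCauchySeqOn_iff] at hu ⊢
    intro ε hε
    -- Differences `F k - F l` then vary by at most `ε r / 4` on balls of radius `r / 2`, so the
    -- Cauchy estimate bounds their derivatives by `ε / 2`.
    obtain ⟨K, hK⟩ := hu (ε * r / 8) (by positivity)
    refine ⟨K, fun k hk l hl y hy => ?_⟩
    have hyr : Metric.ball y (r / 2) ⊆ Metric.ball x r := by
      refine Metric.ball_subset_ball' ?_
      have := Metric.mem_ball.1 hy
      linarith
    have hyx : y ∈ Metric.ball x r := hyr (Metric.mem_ball_self (by positivity))
    have hmaps : Set.MapsTo (F k - F l) (Metric.ball y (r / 2))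
        (Metric.closedBall ((F k - F l) y) (ε * r / 4)) := by
      intro z hz
      have h1 := hK k hk l hl z (hyr hz)
      have h2 := hK k hk l hl y hyx
      rw [dist_eq_norm] at h1 h2
      rw [Metric.mem_closedBall, dist_eq_norm]
      exact (norm_sub_le _ _).trans (by simp only [Pi.sub_apply]; linarith)
    have h3 := Complex.norm_fderiv_le_div_of_mapsTo_ball (((hF k).mono (hyr.trans hrs)).sub
      ((hF l).mono (hyr.trans hrs))) hmaps (by positivity)
    rw [fderiv_sub (hd k y hyx).differentiableAt (hd l y hyx).differentiableAt] at h3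
    rw [dist_eq_norm]
    refine h3.trans_lt ?_
    rw [div_lt_iff₀ (by positivity)]
    nlinarith [mul_pos hε hr]
  have hlim : ∀ y ∈ Metric.ball x (r / 2), ∃ L, Filter.Tendsto (fun k => fderiv ℂ (F k) y)
      Filter.atTop (nhds L) := fun y hy => cauchySeq_tendsto_of_complete (hu'.cauchySeq hy)
  choose! g hg using hlim
  have h := hasFDerivAt_of_tendstoLocallyUniformlyOn Metric.isOpen_ball
    (hu'.tendstoUniformlyOn_of_tendsto hg).tendstoLocallyUniformlyOn
    (fun k y hy => hd k y (Metric.ball_subset_ball (by linarith) hy))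
    (fun y hy => hf y (hrs (Metric.ball_subset_ball (by linarith) hy)))
    (Metric.mem_ball_self (show 0 < r / 2 by positivity))
  exact h.differentiableAt.differentiableWithinAt

namespace ColoredConformal

variable {N n : ℕ}

/-- Since `detR 0 = 1`, the automorphy factor at the origin satisfies `|det den|^(-2) = detR (mob g
0)`. This carries statements about evaluation at `0` to every point of the ball. -/
theorem rep_inv_zero (hn : 4 * N ≤ n) (g : pseudoUnitary (2 * N)) (f : bergman N n) :
    ‖rep (bergmanRepr hn g⁻¹ f) 0‖ ^ 2 = detR (mob g 0) ^ n * ‖rep f (mob g 0)‖ ^ 2 := by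
  have h0 := zero_mem_matrixBall (2 * N)
  have h1 := detR_mob g h0
  have h2 : detR (0 : Matrix (Fin (2 * N)) (Fin (2 * N)) ℂ) = 1 := by simp [detR]
  rw [h2] at h1
  have h3 : detR (mob g 0) = (‖(den g 0).det‖ ^ 2)⁻¹ := eq_inv_of_mul_eq_one_right h1
  rw [rep_bergmanRepr hn _ _ h0, act_apply, inv_inv, norm_mul, mul_pow, h3, norm_zpow, zpow_neg,
    zpow_natCast, inv_pow, inv_pow]
  ring_nf

theorem norm_rep_zero_le (hn : 4 * N ≤ n) (f : bergman N n) :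
    ‖bergmanOne N n‖ ^ 2 * ‖rep f 0‖ ^ 2 ≤ ‖f‖ ^ 2 := by
  have h1 := congrArg norm (rep_zero_mul hn f)
  have h2 := norm_inner_le_norm (𝕜 := ℂ) (bergmanOne N n) f
  have h0 : inner ℂ (bergmanOne N n) (bergmanOne N n) = (‖bergmanOne N n‖ : ℂ) ^ 2 :=
    inner_self_eq_norm_sq_to_K _
  rw [norm_mul, h0] at h1
  rw [← h1] at h2
  have h3 : 0 < ‖bergmanOne N n‖ := norm_pos_iff.2 (bergmanOne_ne_zero N n)
  have h4 : ‖((‖bergmanOne N n‖ : ℂ)) ^ 2‖ = ‖bergmanOne N n‖ ^ 2 := by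
    rw [norm_pow, Complex.norm_real, norm_norm]
  have h5 : ‖bergmanOne N n‖ * ‖rep f 0‖ ≤ ‖f‖ := by
    refine le_of_mul_le_mul_left ?_ h3
    calc _ = ‖bergmanOne N n‖ ^ 2 * ‖rep f 0‖ := by ring
      _ ≤ _ := by rw [← h4]; exact h2
  rw [← mul_pow]
  exact pow_le_pow_left₀ (by positivity) h5 2

/-- Point evaluations on the Bergman space are bounded. -/
theorem norm_rep_sq_le (hn : 4 * N ≤ n) (f : bergman N n) {Z : Matrix (Fin (2 * N)) (Fin (2 * N)) ℂ}
    (hZ : Z ∈ matrixBall (2 * N)) :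
    ‖rep f Z‖ ^ 2 ≤ (‖bergmanOne N n‖ ^ 2 * detR Z ^ n)⁻¹ * ‖f‖ ^ 2 := by
  obtain ⟨g, rfl⟩ := exists_mob_zero hZ
  have h1 := norm_rep_zero_le hn (bergmanRepr hn g⁻¹ f)
  rw [rep_inv_zero, LinearIsometryEquiv.norm_map, ← mul_assoc] at h1
  have h2 := detR_pos hZ
  have h3 : 0 < ‖bergmanOne N n‖ := norm_pos_iff.2 (bergmanOne_ne_zero N n)
  rw [inv_mul_eq_div, le_div_iff₀ (by positivity), mul_comm]
  exact h1

theorem rep_sub (f g : bergman N n) {Z : Matrix (Fin (2 * N)) (Fin (2 * N)) ℂ}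
    (hZ : Z ∈ matrixBall (2 * N)) : rep (f - g) Z = rep f Z - rep g Z := by
  have h1 := rep_add (f - g) g hZ
  rw [sub_add_cancel, Pi.add_apply] at h1
  exact eq_sub_of_add_eq h1.symm

/-- The bound on point evaluations degenerates only as `detR` tends to zero. -/
theorem uniformCauchySeqOn_rep (hn : 4 * N ≤ n) {u : ℕ → bergman N n} (hu : CauchySeq u)
    {s : Set (Matrix (Fin (2 * N)) (Fin (2 * N)) ℂ)} (hs : s ⊆ matrixBall (2 * N)) {δ : ℝ}
    (hδ : 0 < δ) (hsδ : ∀ Z ∈ s, δ ≤ detR Z) :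
    UniformCauchySeqOn (fun k => rep (u k)) Filter.atTop s := by
  rw [Metric.uniformCauchySeqOn_iff]
  intro ε hε
  have h3 : 0 < ‖bergmanOne N n‖ := norm_pos_iff.2 (bergmanOne_ne_zero N n)
  set C := ‖bergmanOne N n‖ ^ 2 * δ ^ n
  have hC : 0 < C := by positivity
  obtain ⟨K, hK⟩ := Metric.cauchySeq_iff.1 hu (ε * Real.sqrt C) (by positivity)
  refine ⟨K, fun k hk l hl Z hZ => ?_⟩
  have h4 := hK k hk l hl
  rw [dist_eq_norm] at h4 ⊢
  rw [← rep_sub _ _ (hs hZ)]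
  refine lt_of_pow_lt_pow_left₀ 2 hε.le ((norm_rep_sq_le hn _ (hs hZ)).trans_lt ?_)
  have h5 : C ≤ ‖bergmanOne N n‖ ^ 2 * detR Z ^ n := by
    exact mul_le_mul_of_nonneg_left (pow_le_pow_left₀ hδ.le (hsδ Z hZ) n) (by positivity)
  have h6 : ‖u k - u l‖ ^ 2 < ε ^ 2 * C := by
    calc _ < (ε * Real.sqrt C) ^ 2 := pow_lt_pow_left₀ h4 (norm_nonneg _) two_ne_zero
      _ = _ := by rw [mul_pow, Real.sq_sqrt hC.le]
  calc _ ≤ C⁻¹ * ‖u k - u l‖ ^ 2 := by gcongr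
    _ < C⁻¹ * (ε ^ 2 * C) := mul_lt_mul_of_pos_left h6 (inv_pos.2 hC)
    _ = ε ^ 2 := by field_simp

theorem exists_holomorphic_limit (hn : 4 * N ≤ n) {u : ℕ → bergman N n} (hu : CauchySeq u) :
    ∃ φ : Matrix (Fin (2 * N)) (Fin (2 * N)) ℂ → ℂ, DifferentiableOn ℂ φ (matrixBall (2 * N)) ∧
      ∀ Z ∈ matrixBall (2 * N), Filter.Tendsto (fun k => rep (u k) Z) Filter.atTop (nhds (φ Z)) := by
  have hlim : ∀ Z ∈ matrixBall (2 * N), ∃ L,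
      Filter.Tendsto (fun k => rep (u k) Z) Filter.atTop (nhds L) := fun Z hZ =>
    cauchySeq_tendsto_of_complete ((uniformCauchySeqOn_rep hn hu (s := {Z})
      (Set.singleton_subset_iff.2 hZ) (detR_pos hZ) (fun W hW => by rw [hW])).cauchySeq
        (Set.mem_singleton Z))
  choose! φ hφ using hlim
  refine ⟨φ, ?_, hφ⟩
  refine differentiableOn_of_uniformCauchySeqOn (E := Fin (2 * N) → Fin (2 * N) → ℂ)
    (fun k => differentiableOn_rep (u k)) hφ fun Z hZ => ?_
  have h1 : {W | detR Z / 2 < detR W} ∩ matrixBall (2 * N) ∈ nhds Z :=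
    Filter.inter_mem ((isOpen_lt continuous_const continuous_detR).mem_nhds
      (half_lt_self (detR_pos hZ))) ((isOpen_matrixBall _).mem_nhds hZ)
  obtain ⟨r, hr, hrs⟩ := Metric.mem_nhds_iff (α := Fin (2 * N) → Fin (2 * N) → ℂ).1 h1
  exact ⟨r, hr, fun W hW => (hrs hW).2, uniformCauchySeqOn_rep hn hu (fun W hW => (hrs hW).2)
    (half_pos (detR_pos hZ)) fun W hW => le_of_lt (hrs hW).1⟩

/-- The locally uniform limit is holomorphic, and it agrees almost everywhere with the `L²` limit
because a subsequence converges almost everywhere to the latter. -/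
theorem isClosed_bergman (hn : 4 * N ≤ n) :
    IsClosed (bergman N n : Set (Lp ℂ 2 (ballMeasure N n))) := by
  refine isClosed_of_closure_subset fun f hf => ?_
  obtain ⟨u, hu, hlim⟩ := mem_closure_iff_seq_limit.1 hf
  let w : ℕ → bergman N n := fun k => ⟨u k, hu k⟩
  have hw : CauchySeq w := by
    have := hlim.cauchySeq
    rw [Metric.cauchySeq_iff] at this ⊢
    exact this
  obtain ⟨φ, hφ, hφl⟩ := exists_holomorphic_limit hn hw
  refine ⟨φ, hφ, ?_⟩
  obtain ⟨ns, hns, hae⟩ := (tendstoInMeasure_of_tendsto_Lp hlim).exists_seq_tendsto_ae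
  have hrep : ∀ k, (u k : _ → ℂ) =ᵐ[ballMeasure N n] rep (w k) := fun k => coe_ae_eq_rep (w k)
  filter_upwards [hae, ae_all_iff.2 hrep, ae_ballMeasure_mem N n] with Z h1 h2 h3
  refine tendsto_nhds_unique h1 ?_
  simp only [h2]
  exact (hφl Z h3).comp hns.tendsto_atTop

theorem completeSpace_bergman (hn : 4 * N ≤ n) : CompleteSpace (bergman N n) :=
  (isClosed_bergman hn).completeSpace_coe

end ColoredConformal

/-! ### Unitary representations with a cyclic vector and an averaging circle -/

theorem MeasureTheory.memLp_two_iff_lintegral {X : Type*} [MeasurableSpace X] {ν : Measure X}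
    {f : X → ℂ} (hf : AEStronglyMeasurable f ν) : MemLp f 2 ν ↔ ∫⁻ x, ‖f x‖ₑ ^ 2 ∂ν < ⊤ := by
  rw [MemLp, eLpNorm_lt_top_iff_lintegral_rpow_enorm_lt_top two_ne_zero ENNReal.ofNat_ne_top]
  simp [hf]

namespace UnitaryRepr

variable {G : Type*} [Group G] {H : Type*} [NormedAddCommGroup H] [InnerProductSpace ℂ H]
  (ρ : G →* (H ≃ₗᵢ[ℂ] H)) {e : H}

theorem map_mul_apply (g h : G) (v : H) : ρ (g * h) v = ρ g (ρ h v) := by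
  rw [map_mul]
  rfl

theorem map_one_apply (v : H) : ρ 1 v = v := by
  rw [map_one]
  rfl

theorem inner_apply_eq (g : G) (v w : H) : inner ℂ v (ρ g w) = inner ℂ (ρ g⁻¹ v) w := by
  rw [← LinearIsometryEquiv.inner_map_map (ρ g) (ρ g⁻¹ v) w, ← map_mul_apply,
    mul_inv_cancel, map_one_apply]

theorem inner_apply_eq_conj (g : G) (v w : H) :
    inner ℂ v (ρ g w) = starRingEnd ℂ (inner ℂ w (ρ g⁻¹ v)) := by
  rw [inner_apply_eq, inner_conj_symm]

theorem inner_apply_apply (g h : G) (v w : H) :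
    inner ℂ (ρ g v) (ρ h w) = inner ℂ v (ρ (g⁻¹ * h) w) := by
  rw [map_mul_apply, inner_apply_eq ρ g⁻¹, inv_inv]

/-- A vector is cyclic if only the zero vector is orthogonal to its orbit. -/
def IsCyclic (ρ : G →* (H ≃ₗᵢ[ℂ] H)) (e : H) : Prop :=
  ∀ u : H, (∀ g, inner ℂ u (ρ g e) = 0) → u = 0

theorem IsCyclic.dense_span [CompleteSpace H] {ρ : G →* (H ≃ₗᵢ[ℂ] H)} (h : IsCyclic ρ e) :
    (Submodule.span ℂ (Set.range fun g => ρ g e)).topologicalClosure = ⊤ := by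
  rw [Submodule.topologicalClosure_eq_top_iff, eq_bot_iff]
  intro u hu
  refine h u fun g => ?_
  exact (Submodule.mem_orthogonal' _ _).1 hu _ (Submodule.subset_span ⟨g, rfl⟩)

/-- `‖ρ(g)e - ρ(g₀)e‖² = 2‖e‖² - 2 Re ⟪e, ρ(g₀⁻¹g)e⟫` gives continuity of the orbit map of `e`.
Vectors with continuous orbit map form a closed subspace, which contains the orbit of `e`. -/
theorem isStronglyContinuous_of_cyclic {ρ : G →* (H ≃ₗᵢ[ℂ] H)} [CompleteSpace H]
    [TopologicalSpace G] [IsTopologicalGroup G] (hcyc : IsCyclic ρ e)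
    (hc : Continuous fun g => inner ℂ e (ρ g e)) : IsStronglyContinuous ρ := by
  have he : Continuous fun g => ρ g e := by
    rw [continuous_iff_continuousAt]
    intro g₀
    rw [ContinuousAt, tendsto_iff_norm_sub_tendsto_zero]
    have h1 : ∀ g, ‖ρ g e - ρ g₀ e‖ =
        Real.sqrt (2 * ‖e‖ ^ 2 - 2 * (inner ℂ e (ρ (g₀⁻¹ * g) e)).re) := by
      intro g
      rw [← Real.sqrt_sq (norm_nonneg (ρ g e - ρ g₀ e)), norm_sub_rev,
        norm_sub_sq (𝕜 := ℂ), LinearIsometryEquiv.norm_map, LinearIsometryEquiv.norm_map,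
        inner_apply_apply]
      congr 1
      change ‖e‖ ^ 2 - 2 * (inner ℂ e (ρ (g₀⁻¹ * g) e)).re + ‖e‖ ^ 2 = _
      ring
    simp only [h1]
    have h2 : Continuous fun g => Real.sqrt
        (2 * ‖e‖ ^ 2 - 2 * (inner ℂ e (ρ (g₀⁻¹ * g) e)).re) := by
      have := hc.comp (continuous_const_mul g₀⁻¹)
      exact Real.continuous_sqrt.comp (continuous_const.sub
        (continuous_const.mul (Complex.continuous_re.comp this)))
    have h3 := h2.tendsto g₀
    have h4 : (inner ℂ e e).re = ‖e‖ ^ 2 := (norm_sq_eq_re_inner (𝕜 := ℂ) e).symm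
    rwa [inv_mul_cancel, map_one_apply, h4, sub_self, Real.sqrt_zero] at h3
  let S : Submodule ℂ H :=
    { carrier := {v | Continuous fun g => ρ g v}
      zero_mem' := by
        change Continuous fun g => ρ g 0
        simpa using continuous_const
      add_mem' := fun {v w} hv hw => by
        change Continuous fun g => ρ g (v + w)
        simp only [map_add]
        exact Continuous.add hv hw
      smul_mem' := fun c v hv => by
        change Continuous fun g => ρ g (c • v)
        simp only [map_smul]
        exact Continuous.const_smul hv c }
  have hS : ∀ v, v ∈ S ↔ Continuous fun g => ρ g v := fun v => Iff.rfl
  have hclosed : IsClosed (S : Set H) := by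
    refine isClosed_of_closure_subset fun v hv => ?_
    refine (hS v).2 (continuous_of_uniform_approx_of_continuous fun u hu => ?_)
    obtain ⟨ε, hε, hεu⟩ := Metric.mem_uniformity_dist.1 hu
    obtain ⟨w, hw, hvw⟩ := Metric.mem_closure_iff.1 hv ε hε
    refine ⟨fun g => ρ g w, (hS w).1 hw, fun g => hεu ?_⟩
    rwa [LinearIsometryEquiv.dist_map]
  have htop : S = ⊤ := by
    rw [eq_top_iff, ← hcyc.dense_span]
    refine Submodule.topologicalClosure_minimal _ (Submodule.span_le.2 ?_) hclosed
    rintro _ ⟨h, rfl⟩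
    refine (hS _).2 ?_
    have := he.comp (continuous_mul_const h)
    refine this.congr fun g => ?_
    simp only [Function.comp_apply, map_mul_apply]
  intro v
  exact (hS v).1 (htop ▸ Submodule.mem_top)

/-- The average of the operators `ρ (k θ)` is the projection to the line of `e`. -/
def AveragesTo (ρ : G →* (H ≃ₗᵢ[ℂ] H)) (k : ℝ → G) (e : H) : Prop :=
  ∀ v u : H, ∫ θ in (0 : ℝ)..2 * Real.pi, inner ℂ v (ρ (k θ) u) =
    2 * Real.pi * (inner ℂ v e * (inner ℂ e u / inner ℂ e e))

theorem two_pi_ne_zero : (2 * Real.pi : ℂ) ≠ 0 := by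
  exact_mod_cast (by positivity : (2 * Real.pi : ℝ) ≠ 0)

/-- An invariant subspace orthogonal to `e` is orthogonal to its orbit, hence zero. Otherwise
averaging some vector of it gives a nonzero multiple of `e`, seen here through the double orthogonal
complement. -/
theorem isIrreducible_of_averagesTo [CompleteSpace H] {ρ : G →* (H ≃ₗᵢ[ℂ] H)} {k : ℝ → G}
    (he : e ≠ 0) (hcyc : IsCyclic ρ e) (havg : AveragesTo ρ k e) : IsIrreducible ρ := by
  refine ⟨⟨e, 0, he⟩, fun K hK hinv => ?_⟩
  have : CompleteSpace K := hK.completeSpace_coe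
  by_cases h : ∀ u ∈ K, inner ℂ e u = 0
  · left
    rw [eq_bot_iff]
    intro u hu
    refine hcyc u fun g => ?_
    rw [inner_apply_eq_conj, h _ (hinv g⁻¹ u hu), map_zero]
  · right
    push Not at h
    obtain ⟨u, hu, heu⟩ := h
    have heK : e ∈ K := by
      rw [← Submodule.orthogonal_orthogonal K, Submodule.mem_orthogonal]
      intro v hv
      have h1 := havg v u
      have h2 : ∀ θ, inner ℂ v (ρ (k θ) u) = 0 := fun θ =>
        (Submodule.mem_orthogonal' _ _).1 hv _ (hinv (k θ) u hu)
      simp only [h2, intervalIntegral.integral_zero] at h1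
      have h3 : inner ℂ e e ≠ 0 := inner_self_ne_zero.2 he
      simpa [two_pi_ne_zero, Real.pi_ne_zero, heu, h3, he] using h1
    rw [← Submodule.orthogonal_eq_bot_iff, eq_bot_iff]
    intro v hv
    exact hcyc v fun g => (Submodule.mem_orthogonal' _ _).1 hv _ (hinv g e heK)

variable {ρ} [TopologicalSpace G]

theorem continuous_coeff (hc : IsStronglyContinuous ρ) (v w : H) :
    Continuous fun g => inner ℂ v (ρ g w) := continuous_const.inner (hc w)

theorem memLp_coeff_iff [MeasurableSpace G] [BorelSpace G] {μ : Measure G}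
    (hc : IsStronglyContinuous ρ) (v w : H) :
    MemLp (fun g => inner ℂ v (ρ g w)) 2 μ ↔ ∫⁻ g, ‖inner ℂ v (ρ g w)‖ₑ ^ 2 ∂μ < ⊤ :=
  memLp_two_iff_lintegral (continuous_coeff hc v w).aestronglyMeasurable

theorem memLp_coeff_apply [IsTopologicalGroup G] [MeasurableSpace G] [BorelSpace G]
    {μ : Measure G} [μ.IsMulRightInvariant] (hc : IsStronglyContinuous ρ) {v w : H} (h : G)
    (hw : MemLp (fun g => inner ℂ v (ρ g w)) 2 μ) :
    MemLp (fun g => inner ℂ v (ρ g (ρ h w))) 2 μ := by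
  have h1 := hw.comp_measurePreserving (measurePreserving_mul_right μ h)
  refine h1.congr_norm (continuous_coeff hc v _).aestronglyMeasurable
    (Filter.Eventually.of_forall fun g => ?_)
  simp only [Function.comp_apply, map_mul_apply]

variable [IsTopologicalGroup G] [SecondCountableTopology G] [MeasurableSpace G] [BorelSpace G]
  {μ : Measure G}

/-- Replacing `g` by `g k(θ)` changes neither the integral nor `ρ(g) e`; averaging over `θ` then
replaces `w` by its projection to the line of `e`. -/
theorem integral_conj_coeff_mul_coeff [μ.IsMulRightInvariant] [SFinite μ]
    (hc : IsStronglyContinuous ρ) {k : ℝ → G} (hk : Continuous k)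
    (hke : ∀ θ, ρ (k θ) e = e) (havg : AveragesTo ρ k e) {v w : H}
    (he2 : MemLp (fun g => inner ℂ v (ρ g e)) 2 μ) (hw2 : MemLp (fun g => inner ℂ v (ρ g w)) 2 μ) :
    ∫ g, starRingEnd ℂ (inner ℂ v (ρ g e)) * inner ℂ v (ρ g w) ∂μ =
      (∫ g, starRingEnd ℂ (inner ℂ v (ρ g e)) * inner ℂ v (ρ g e) ∂μ) *
        (inner ℂ e w / inner ℂ e e) := by
  have h1 : ∀ θ, ∫ g, starRingEnd ℂ (inner ℂ v (ρ g e)) * inner ℂ v (ρ (g * k θ) w) ∂μ =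
      ∫ g, starRingEnd ℂ (inner ℂ v (ρ g e)) * inner ℂ v (ρ g w) ∂μ := by
    intro θ
    rw [← integral_mul_right_eq_self (fun g => starRingEnd ℂ (inner ℂ v (ρ g e)) *
      inner ℂ v (ρ g w)) (k θ)]
    simp only [map_mul_apply, hke]
  have hb : Continuous (Function.uncurry fun θ g => inner ℂ v (ρ (g * k θ) w)) :=
    (continuous_coeff hc v w).comp (continuous_snd.mul (hk.comp continuous_fst))
  have hb2 : ∀ θ, ∫⁻ g, ‖inner ℂ v (ρ (g * k θ) w)‖ₑ ^ 2 ∂μ ≤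
      ∫⁻ g, ‖inner ℂ v (ρ g w)‖ₑ ^ 2 ∂μ := fun θ =>
    (lintegral_mul_right_eq_self (fun g => ‖inner ℂ v (ρ g w)‖ₑ ^ 2) (k θ)).le
  have h2 := intervalIntegral_integral_conj_mul_swap μ
    (continuous_coeff hc v e).measurable hb.measurable ((memLp_coeff_iff hc v e).1 he2).ne
    ((memLp_coeff_iff hc v w).1 hw2).ne le_rfl hb2 (2 * Real.pi) (by positivity)
  have h3 : ∀ g, ∫ θ in (0 : ℝ)..2 * Real.pi, inner ℂ v (ρ (g * k θ) w) =
      2 * Real.pi * (inner ℂ v (ρ g e) * (inner ℂ e w / inner ℂ e e)) := by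
    intro g
    rw [inner_apply_eq, ← havg]
    simp only [map_mul_apply, inner_apply_eq ρ g]
  simp only [h1, h3, intervalIntegral.integral_const, sub_zero, Complex.real_smul] at h2
  refine mul_left_cancel₀ two_pi_ne_zero ?_
  push_cast at h2
  rw [h2, ← integral_mul_const, ← integral_const_mul]
  refine integral_congr_ae (Filter.Eventually.of_forall fun g => ?_)
  simp only
  ring

/-- Schur's orthogonality relation on the span of the orbit of `e`. -/
theorem integral_conj_coeff_of_mem_span [μ.IsMulRightInvariant] [SFinite μ]
    (hc : IsStronglyContinuous ρ) {k : ℝ → G}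
    (hk : Continuous k) (hke : ∀ θ, ρ (k θ) e = e) (havg : AveragesTo ρ k e) {v : H}
    (he2 : MemLp (fun g => inner ℂ v (ρ g e)) 2 μ) {w : H}
    (hw : w ∈ Submodule.span ℂ (Set.range fun g => ρ g e)) :
    MemLp (fun g => inner ℂ v (ρ g w)) 2 μ ∧
      ∀ w', MemLp (fun g => inner ℂ v (ρ g w')) 2 μ →
        ∫ g, starRingEnd ℂ (inner ℂ v (ρ g w)) * inner ℂ v (ρ g w') ∂μ =
          (∫ g, starRingEnd ℂ (inner ℂ v (ρ g e)) * inner ℂ v (ρ g e) ∂μ) *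
            (inner ℂ w w' / inner ℂ e e) := by
  have hint : ∀ {w w' : H}, MemLp (fun g => inner ℂ v (ρ g w)) 2 μ →
      MemLp (fun g => inner ℂ v (ρ g w')) 2 μ →
      Integrable (fun g => starRingEnd ℂ (inner ℂ v (ρ g w)) * inner ℂ v (ρ g w')) μ :=
    fun h h' => MemLp.integrable_mul (p := 2) (q := 2) h.star h'
  induction hw using Submodule.span_induction with
  | mem x hx =>
    obtain ⟨h, rfl⟩ := hx
    refine ⟨memLp_coeff_apply hc h he2, fun w' hw' => ?_⟩
    -- For `w = ρ(h) e`, the substitution `g ↦ g h` moves `h⁻¹` to `w'` and reduces to the case `w =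
    -- e`.
    have h1 := integral_conj_coeff_mul_coeff hc hk hke havg he2 (memLp_coeff_apply hc h⁻¹ hw')
    rw [inner_apply_eq ρ h⁻¹, inv_inv] at h1
    rw [← h1, ← integral_mul_right_eq_self (fun g => starRingEnd ℂ (inner ℂ v (ρ g e)) *
      inner ℂ v (ρ g (ρ h⁻¹ w'))) h]
    refine integral_congr_ae (Filter.Eventually.of_forall fun g => ?_)
    simp only [← map_mul_apply, mul_assoc, mul_inv_cancel, mul_one]
  | zero => simp
  | add x y hx hy ihx ihy =>
    refine ⟨?_, fun w' hw' => ?_⟩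
    · simp only [map_add, inner_add_right]
      exact ihx.1.add ihy.1
    · simp only [map_add, inner_add_right, add_mul, inner_add_left]
      rw [integral_add (hint ihx.1 hw') (hint ihy.1 hw'), ihx.2 w' hw', ihy.2 w' hw']
      ring
  | smul c x hx ihx =>
    refine ⟨?_, fun w' hw' => ?_⟩
    · simp only [map_smul, inner_smul_right]
      exact ihx.1.const_mul c
    · simp only [map_smul, inner_smul_right, map_mul, mul_assoc, inner_smul_left]
      rw [integral_const_mul, ihx.2 w' hw']
      ring

/-- Orthogonality with `w' = w` gives `∫ |⟪v, ρ(g) w⟫|² = C ‖w‖²` on the span of the orbit, with `C`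
independent of `w`. The span is dense, and Fatou's lemma carries the bound to limits. -/
theorem isSquareIntegrable_of_averagesTo [CompleteSpace H] [μ.IsMulRightInvariant] [SFinite μ]
    (hc : IsStronglyContinuous ρ) {k : ℝ → G}
    (hk : Continuous k) (hke : ∀ θ, ρ (k θ) e = e) (havg : AveragesTo ρ k e)
    (hcyc : IsCyclic ρ e) (he2 : ∀ v, MemLp (fun g => inner ℂ v (ρ g e)) 2 μ) :
    IsSquareIntegrable μ ρ := by
  intro v w
  set I : ℂ := ∫ g, starRingEnd ℂ (inner ℂ v (ρ g e)) * inner ℂ v (ρ g e) ∂μ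
  set C : ℝ := ‖I / inner ℂ e e‖
  have hbound : ∀ w ∈ Submodule.span ℂ (Set.range fun g => ρ g e),
      ∫⁻ g, ‖inner ℂ v (ρ g w)‖ₑ ^ 2 ∂μ ≤ ENNReal.ofReal (C * ‖w‖ ^ 2) := by
    intro w hw
    obtain ⟨h1, h2⟩ := integral_conj_coeff_of_mem_span hc hk hke havg (he2 v) hw
    have h3 := congrArg norm (h2 w h1)
    have h4 : ∀ g, starRingEnd ℂ (inner ℂ v (ρ g w)) * inner ℂ v (ρ g w) =
        ((‖inner ℂ v (ρ g w)‖ ^ 2 : ℝ) : ℂ) := fun g => by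
      rw [Complex.conj_mul']; push_cast; rfl
    simp only [h4] at h3
    rw [integral_complex_ofReal, Complex.norm_real, Real.norm_of_nonneg
      (integral_nonneg fun g => sq_nonneg _)] at h3
    have h5 : ∫⁻ g, ‖inner ℂ v (ρ g w)‖ₑ ^ 2 ∂μ =
        ENNReal.ofReal (∫ g, ‖inner ℂ v (ρ g w)‖ ^ 2 ∂μ) := by
      rw [ofReal_integral_eq_lintegral_ofReal h1.norm.integrable_sq
        (Filter.Eventually.of_forall fun g => sq_nonneg _)]
      refine lintegral_congr fun g => ?_
      rw [← ofReal_norm, ENNReal.ofReal_pow (norm_nonneg _)]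
    rw [h5, h3]
    refine ENNReal.ofReal_le_ofReal (le_of_eq ?_)
    have h6 : ‖inner ℂ w w‖ = ‖w‖ ^ 2 := by
      rw [inner_self_eq_norm_sq_to_K]
      simp
    rw [norm_mul, norm_div, h6]
    simp only [C, norm_div]
    ring
  rw [memLp_coeff_iff hc]
  have hw : w ∈ closure (Submodule.span ℂ (Set.range fun g => ρ g e) : Set H) := by
    rw [← Submodule.topologicalClosure_coe, hcyc.dense_span]
    exact Submodule.mem_top
  obtain ⟨u, hu, hlim⟩ := mem_closure_iff_seq_limit.1 hw
  have h1 : ∀ g, Filter.Tendsto (fun j => ‖inner ℂ v (ρ g (u j))‖ₑ ^ 2) Filter.atTop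
      (nhds (‖inner ℂ v (ρ g w)‖ₑ ^ 2)) := by
    intro g
    have h2 : Continuous fun x => ‖inner ℂ v (ρ g x)‖ₑ ^ 2 :=
      (ENNReal.continuous_pow 2).comp (continuous_const.inner (ρ g).continuous).enorm
    exact (h2.tendsto w).comp hlim
  calc ∫⁻ g, ‖inner ℂ v (ρ g w)‖ₑ ^ 2 ∂μ
      = ∫⁻ g, Filter.liminf (fun j => ‖inner ℂ v (ρ g (u j))‖ₑ ^ 2) Filter.atTop ∂μ :=
        lintegral_congr fun g => (h1 g).liminf_eq.symm
    _ ≤ Filter.liminf (fun j => ∫⁻ g, ‖inner ℂ v (ρ g (u j))‖ₑ ^ 2 ∂μ) Filter.atTop :=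
        lintegral_liminf_le fun j => (continuous_coeff hc v (u j)).measurable.enorm.pow_const 2
    _ ≤ Filter.liminf (fun j => ENNReal.ofReal (C * ‖u j‖ ^ 2)) Filter.atTop :=
        Filter.liminf_le_liminf (Filter.Eventually.of_forall fun j => hbound _ (hu j))
    _ = ENNReal.ofReal (C * ‖w‖ ^ 2) :=
        (ENNReal.tendsto_ofReal ((hlim.norm.pow 2).const_mul C)).liminf_eq
    _ < ⊤ := ENNReal.ofReal_lt_top

end UnitaryRepr

/-! ### Cyclicity, continuity and square-integrability for the constant function -/

namespace ColoredConformal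

variable {N n : ℕ}

theorem inner_bergmanOne_self_ne_zero (N n : ℕ) :
    inner ℂ (bergmanOne N n) (bergmanOne N n) ≠ 0 :=
  inner_self_ne_zero.2 (bergmanOne_ne_zero N n)

/-- Up to a nonzero factor, `|⟪u, ρ(g) 1⟫|` is `|u(mob g 0)|`, and the orbit of the origin is the
whole ball. -/
theorem isCyclic_bergmanOne (hn : 4 * N ≤ n) :
    UnitaryRepr.IsCyclic (bergmanRepr hn) (bergmanOne N n) := by
  intro u hu
  refine ext_rep fun Z hZ => ?_
  have h0 : rep (0 : bergman N n) Z = 0 := by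
    have := rep_smul 0 (0 : bergman N n) hZ
    rw [zero_smul] at this
    rw [this, Pi.smul_apply, zero_smul]
  obtain ⟨g, rfl⟩ := exists_mob_zero hZ
  have h1 : inner ℂ (bergmanOne N n) (bergmanRepr hn g⁻¹ u) = 0 := by
    rw [UnitaryRepr.inner_apply_eq_conj, inv_inv, hu, map_zero]
  rw [← rep_zero_mul hn] at h1
  have h2 := (mul_eq_zero.1 h1).resolve_left (inner_bergmanOne_self_ne_zero N n)
  have h3 := rep_inv_zero hn g u
  rw [h2, norm_zero, zero_pow two_ne_zero, eq_comm] at h3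
  have h4 := (mul_eq_zero.1 h3).resolve_left (pow_ne_zero _ (detR_pos hZ).ne')
  rw [h0]
  exact norm_eq_zero.1 (pow_eq_zero_iff two_ne_zero |>.1 h4)

theorem averagesTo_rotElt (hn : 4 * N ≤ n) :
    UnitaryRepr.AveragesTo (bergmanRepr hn) (rotElt (2 * N)) (bergmanOne N n) := by
  intro v u
  rw [integral_inner_rotElt, ← rep_zero_mul hn u,
    mul_div_cancel_left₀ _ (inner_bergmanOne_self_ne_zero N n)]

/-- The coefficient is a constant times the value of `act n g 1` at the origin, which is
`det(A†)^(-n)`. -/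
theorem continuous_inner_bergmanOne (hn : 4 * N ≤ n) :
    Continuous fun g => inner ℂ (bergmanOne N n) (bergmanRepr hn g (bergmanOne N n)) := by
  have h0 := zero_mem_matrixBall (2 * N)
  have h1 : ∀ g, inner ℂ (bergmanOne N n) (bergmanRepr hn g (bergmanOne N n)) =
      inner ℂ (bergmanOne N n) (bergmanOne N n) * ((blkA g)ᴴ.det) ^ (-(n : ℤ)) := by
    intro g
    rw [← rep_zero_mul hn, rep_bergmanRepr hn _ _ h0, act_apply, rep_bergmanOne (mob_mem _ h0),
      den_zero, blkA_inv, mul_one]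
  simp only [h1]
  refine continuous_const.mul (Continuous.zpow₀ ?_ _ fun g => Or.inl ?_)
  · exact continuous_blkA.matrix_conjTranspose.matrix_det
  · rw [← blkA_inv, ← den_zero]
    exact det_den_ne_zero _ h0

theorem isStronglyContinuous_bergmanRepr (hn : 4 * N ≤ n) :
    UnitaryRepr.IsStronglyContinuous (bergmanRepr hn) :=
  have := completeSpace_bergman hn
  UnitaryRepr.isStronglyContinuous_of_cyclic (isCyclic_bergmanOne hn)
    (continuous_inner_bergmanOne hn)

theorem norm_inner_bergmanOne_sq (hn : 4 * N ≤ n) (v : bergman N n) (g : pseudoUnitary (2 * N)) :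
    ‖inner ℂ v (bergmanRepr hn g (bergmanOne N n))‖ ^ 2 =
      ‖bergmanOne N n‖ ^ 4 * (detR (mob g 0) ^ n * ‖rep v (mob g 0)‖ ^ 2) := by
  have h : ‖inner ℂ (bergmanOne N n) (bergmanOne N n)‖ = ‖bergmanOne N n‖ ^ 2 := by
    rw [inner_self_eq_norm_sq_to_K]
    simp
  rw [UnitaryRepr.inner_apply_eq_conj, RCLike.norm_conj, ← rep_zero_mul hn,
    norm_mul, mul_pow, rep_inv_zero, h]
  ring

/-- `detR^n` times the invariant density `detR^(-4N)` is the density of `ballMeasure` up to `c_n`,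
so this is `‖v‖²` up to a factor. -/
theorem lintegral_invMeas_rep_lt_top (hn : 4 * N ≤ n) (v : bergman N n) :
    ∫⁻ Z in matrixBall (2 * N), ENNReal.ofReal (detR Z ^ (2 * (2 * N)))⁻¹ *
      ENNReal.ofReal (detR Z ^ n * ‖rep v Z‖ ^ 2) < ⊤ := by
  have h := lintegral_rep_lt_top v
  rw [lintegral_ballMeasure] at h
  have hc := cConst_pos N n
  have h1 : ∫⁻ Z in matrixBall (2 * N), ENNReal.ofReal (detR Z ^ (2 * (2 * N)))⁻¹ *
      ENNReal.ofReal (detR Z ^ n * ‖rep v Z‖ ^ 2) =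
      ∫⁻ Z in matrixBall (2 * N), ENNReal.ofReal (cConst N n)⁻¹ *
        (ENNReal.ofReal (cConst N n * detR Z ^ (n - 4 * N)) * ‖rep v Z‖ₑ ^ 2) := by
    refine setLIntegral_congr_fun (measurableSet_matrixBall _) fun Z hZ => ?_
    have hd := detR_pos hZ
    rw [← ofReal_norm, ← ENNReal.ofReal_pow (norm_nonneg _), ← ENNReal.ofReal_mul (by positivity),
      ← ENNReal.ofReal_mul (by positivity), ← ENNReal.ofReal_mul (by positivity)]
    congr 1
    have h2 : detR Z ^ n = detR Z ^ (2 * (2 * N)) * detR Z ^ (n - 4 * N) := by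
      rw [← pow_add]
      congr 1
      omega
    rw [h2]
    field_simp
  rw [h1, lintegral_const_mul' _ _ ENNReal.ofReal_ne_top]
  exact ENNReal.mul_lt_top ENNReal.ofReal_lt_top h

theorem memLp_inner_bergmanOne (hn : 4 * N ≤ n) (v : bergman N n) :
    MemLp (fun g => inner ℂ v (bergmanRepr hn g (bergmanOne N n))) 2
      (Measure.haar : Measure (pseudoUnitary (2 * N))) := by
  classical
  rw [UnitaryRepr.memLp_coeff_iff (isStronglyContinuous_bergmanRepr hn)]
  have hm : Measurable ((matrixBall (2 * N)).indicator (rep v)) := by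
    rw [← Set.piecewise_eq_indicator]
    exact (differentiableOn_rep v).continuousOn.measurable_piecewise continuousOn_const
      (measurableSet_matrixBall _)
  let F : Matrix (Fin (2 * N)) (Fin (2 * N)) ℂ → ENNReal := fun Z => ENNReal.ofReal
    (detR Z ^ n * ‖(matrixBall (2 * N)).indicator (rep v) Z‖ ^ 2)
  have hF : Measurable F :=
    ((continuous_detR.measurable.pow_const n).mul (hm.norm.pow_const 2)).ennreal_ofReal
  obtain ⟨c, hc, h⟩ := exists_lintegral_haar_eq (2 * N)
  have h1 : ∀ g, ‖inner ℂ v (bergmanRepr hn g (bergmanOne N n))‖ₑ ^ 2 =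
      ENNReal.ofReal (‖bergmanOne N n‖ ^ 4) * F (mob g 0) := by
    intro g
    rw [← ofReal_norm, ← ENNReal.ofReal_pow (norm_nonneg _), norm_inner_bergmanOne_sq,
      ENNReal.ofReal_mul (by positivity)]
    simp only [F]
    rw [Set.indicator_of_mem (mob_mem g (zero_mem_matrixBall _))]
  have h2 : ∫⁻ Z, F Z ∂invMeas (2 * N) < ⊤ := by
    rw [lintegral_invMeas hF]
    refine lt_of_eq_of_lt ?_ (lintegral_invMeas_rep_lt_top hn v)
    refine setLIntegral_congr_fun (measurableSet_matrixBall _) fun Z hZ => ?_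
    simp only [F]
    rw [Set.indicator_of_mem hZ]
  simp only [h1]
  rw [lintegral_const_mul' _ _ ENNReal.ofReal_ne_top, h F hF]
  exact ENNReal.mul_lt_top ENNReal.ofReal_lt_top (ENNReal.mul_lt_top hc.lt_top h2)

end ColoredConformal

theorem mainTheorem1 (N n : ℕ) (hN : 1 ≤ N) (hn : 4 * N ≤ n) :
    CompleteSpace (ColoredConformal.bergman N n) ∧
    ∃ ρ : ColoredConformal.pseudoUnitary (2 * N) →*
        (ColoredConformal.bergman N n ≃ₗᵢ[ℂ] ColoredConformal.bergman N n),
      (∀ (U : ColoredConformal.pseudoUnitary (2 * N)) (f : ColoredConformal.bergman N n)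
          (φ : Matrix (Fin (2 * N)) (Fin (2 * N)) ℂ → ℂ),
        DifferentiableOn ℂ φ (ColoredConformal.matrixBall (2 * N)) →
        (f : Lp ℂ 2 (ColoredConformal.ballMeasure N n))
          =ᵐ[ColoredConformal.ballMeasure N n] φ →
        DifferentiableOn ℂ (ColoredConformal.act n U φ) (ColoredConformal.matrixBall (2 * N)) ∧
        (ρ U f : Lp ℂ 2 (ColoredConformal.ballMeasure N n))
          =ᵐ[ColoredConformal.ballMeasure N n] ColoredConformal.act n U φ) ∧
      UnitaryRepr.IsStronglyContinuous ρ ∧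
      UnitaryRepr.IsIrreducible ρ ∧
      UnitaryRepr.IsSquareIntegrable
        (Measure.haar : Measure (ColoredConformal.pseudoUnitary (2 * N))) ρ := by
  have hcomplete := ColoredConformal.completeSpace_bergman hn
  have hcont := ColoredConformal.isStronglyContinuous_bergmanRepr hn
  have hcyc := ColoredConformal.isCyclic_bergmanOne hn
  have havg := ColoredConformal.averagesTo_rotElt hn
  exact ⟨hcomplete, ColoredConformal.bergmanRepr hn, ColoredConformal.bergmanRepr_spec hn, hcont,
    UnitaryRepr.isIrreducible_of_averagesTo (ColoredConformal.bergmanOne_ne_zero N n) hcyc havg,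
    UnitaryRepr.isSquareIntegrable_of_averagesTo hcont (ColoredConformal.continuous_rotElt (2 * N))
      (ColoredConformal.bergmanRepr_rotElt_one hn) havg hcyc
      (ColoredConformal.memLp_inner_bergmanOne hn)⟩
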